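/- Let $H$ be a real separable Hilbert space, $\bar y\in H$ with $|\bar y|=1$, and set $x_1=\langle x,\bar y\rangle$, $H_+=\{x\in H: x_1>0\}$, $\overline{H_+}=\{x\in H: x_1\ge 0\}$, $\partial H_+=\{x\in H: x_1=0\}$; write $x=(x_1,x')$, where $x'$ is the component of $x$ orthogonal to $\bar y$. Let $Q$ be a positive, self-adjoint, trace class operator on $H$, and let $A\colon D(A)\subset H\to H$ be a linear operator such that: (a) $A$ generates a $C_0$-semigroup $(e^{tA})_{t\ge 0}$ on $H$; (b) there is $\alpha\in\mathbb R$ with $A\bar y=\alpha\bar y$ and $A^*\bar y=\alpha\bar y$; (c) there is $\lambda>0$ with $Q\bar y=\lambda\bar y$; (d) $e^{tA}Q=Qe^{tA}$ for all $t\ge 0$; (e) $Q_t:=\int_0^t e^{sA}Qe^{sA^*}\,ds$ is of trace class for all $t>0$; (f) there is $\gamma\in(0,1)$ such that $\int_0^t s^{-\gamma}e^{sA}Qe^{sA^*}\,ds$ is of trace class for all $t>0$; (g) $\operatorname{Im} e^{tA}\subset \operatorname{Im} Q_t^{1/2}$ for all $t>0$. For a bounded Borel measurable function $f\colon H\to\mathbb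 R$ put $$T_tf(x)=\int_H f(z)\,\mathcal N(e^{tA}x,Q_t)(dz),\qquad t\ge 0,\ x\in H,$$ where $\mathcal N(m,B)$ is the Gaussian measure on $H$ with mean $m$ and covariance operator $B$ (and $Q_0=0$). Let $B_b(\overline{H_+})$ and $B_b(H_+)$ be the spaces of bounded Borel measurable real functions on $\overline{H_+}$ and $H_+$, with the supremum norm. For $\eta\in B_b(\overline{H_+})$ let $E\eta(x)=\eta(x_1,x')$ if $x_1\ge 0$ and $E\eta(x)=-\eta(-x_1,x')$ if $x_1<0$. For $\eta\in B_b(H_+)$ let $E\eta(x)=\eta(x_1,x')$ if $x_1>0$, $E\eta(x)=0$ if $x_1=0$, and $E\eta(x)=-\eta(-x_1,x')$ if $x_1<0$. In both cases let $P_t\eta=RT_tE\eta$ for $t\ge 0$, where $R$ denotes restriction of functions from $H$ to $\overline{H_+}$. Let $C_0(\overline{H_+})$ and $UC_0(\overline{H_+})$ be the sets of bounded continuous, respectively bounded uniformly continuous, real functions on $\overline{H_+}$ that vanish on $\partial H_+$. Then $\{P_t\}_{t\ge 0}$ is a semigroup of contractions on $B_b(\overline{H_+})$: each $P_t$ is a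 linear map of $B_b(\overline{H_+})$ into itself with $\|P_tf\|\le\|f\|$ for all $f$, $P_0$ is the identity, and $P_{s+t}=P_sP_t$ for all $s,t\ge 0$. Moreover: (i) $P_t(B_b(\overline{H_+}))\subset UC_0(\overline{H_+})$ and $P_t(B_b(H_+))\subset UC_0(\overline{H_+})$ for all $t>0$; (ii) for every $f\in C_0(\overline{H_+})$ and every $x\in\overline{H_+}$, the map $t\mapsto P_tf(x)$, from $[0,+\infty)$ to $\mathbb R$, is continuous. -/

import Mathlib

open MeasureTheory ProbabilityTheory Filter Topology
open scoped NNReal RealInnerProductSpace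

namespace HalfSpaceOU

noncomputable section

variable {H : Type*} [NormedAddCommGroup H] [InnerProductSpace ℝ H]

/-! ### Operators and semigroups on the Hilbert space -/

/-- A `C₀`-semigroup `(e^{tA})_{t ≥ 0}` of bounded linear operators: a one-parameter semigroup
all of whose orbits are continuous on `[0, ∞)`. -/
structure C0Semigroup (H : Type*) [NormedAddCommGroup H] [InnerProductSpace ℝ H] where
  /-- the operator at time `t ≥ 0` -/
  op : ℝ≥0 → H →L[ℝ] H
  op_zero : op 0 = ContinuousLinearMap.id ℝ H
  op_add : ∀ s t, op (s + t) = op s ∘L op t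
  continuous_orbit : ∀ x, Continuous fun t => op t x

/-- The (possibly unbounded) operator `A : D(A) ⊂ H → H` is the infinitesimal generator of `S`:
`x ∈ D(A)` and `A x = z` exactly when `(S(h) x - x) / h → z` as `h ↓ 0`. -/
def IsGenerator (A : H →ₗ.[ℝ] H) (S : C0Semigroup H) : Prop :=
  ∀ x z : H, (x, z) ∈ A.graph ↔
    Tendsto (fun h : ℝ≥0 => (h : ℝ)⁻¹ • (S.op h x - x)) (𝓝[>] 0) (𝓝 z)

/-- Trace class (nuclear) operators: `T x = ∑ₙ ⟪aₙ, x⟫ bₙ` with `∑ₙ ‖aₙ‖ ‖bₙ‖ < ∞`. -/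
def IsTraceClass (T : H →L[ℝ] H) : Prop :=
  ∃ a b : ℕ → H, Summable (fun n => ‖a n‖ * ‖b n‖) ∧
    ∀ x, HasSum (fun n => ⟪a n, x⟫ • b n) (T x)

/-- The operator `∫₀ᵗ w(s) e^{sA} Q e^{sA*} ds` with a scalar weight `w`. When `Q` is of trace
class the map `s ↦ e^{sA} Q e^{sA*}` is continuous for the operator norm, so this Bochner integral
in the space of bounded operators is the usual (strong) operator integral. -/
def weightedCov [CompleteSpace H] (S : C0Semigroup H) (Q : H →L[ℝ] H) (w : ℝ → ℝ) (t : ℝ≥0) :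
    H →L[ℝ] H :=
  ∫ s in (0 : ℝ)..t,
    w s • (S.op s.toNNReal ∘L Q ∘L ContinuousLinearMap.adjoint (S.op s.toNNReal))

/-- `Q_t = ∫₀ᵗ e^{sA} Q e^{sA*} ds`. -/
def covOp [CompleteSpace H] (S : C0Semigroup H) (Q : H →L[ℝ] H) (t : ℝ≥0) : H →L[ℝ] H :=
  weightedCov S Q (fun _ => 1) t

/-- The standing assumptions on the drift operator `A`, the semigroup `S(t) = e^{tA}`, the
covariance operator `Q` and the direction `y` which determines the half-space. -/
structure StandingHypothesis [CompleteSpace H] (A : H →ₗ.[ℝ] H) (S : C0Semigroup H)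
    (Q : H →L[ℝ] H) (y : H) : Prop where
  /-- `Q` is positive and self-adjoint -/
  positive : Q.IsPositive
  traceClass : IsTraceClass Q
  generator : IsGenerator A S
  /-- `y` lies in `D(A) ∩ D(A*)`, with `A y = α y` and `A* y = α y` -/
  eigen_drift : ∃ α : ℝ, (y, α • y) ∈ A.graph ∧ (y, α • y) ∈ A.adjoint.graph
  eigen_noise : ∃ l : ℝ, 0 < l ∧ Q y = l • y
  commute : ∀ t, S.op t ∘L Q = Q ∘L S.op t
  traceClass_cov : ∀ t, 0 < t → IsTraceClass (covOp S Q t)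
  traceClass_weighted : ∃ γ : ℝ, 0 < γ ∧ γ < 1 ∧
    ∀ t, 0 < t → IsTraceClass (weightedCov S Q (fun s => s ^ (-γ)) t)
  /-- `im e^{tA} ⊆ im Q_t^{1/2}`; here `R` is the positive square root of `Q_t` -/
  range_subset : ∀ t, 0 < t → ∃ R : H →L[ℝ] H, R.IsPositive ∧ R ∘L R = covOp S Q t ∧
    Set.range (S.op t) ⊆ Set.range R

/-! ### Gaussian measures and the Ornstein–Uhlenbeck semigroup on the whole space -/

/-- `μ` is a Gaussian measure with mean `m` and covariance operator `B`. -/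
def IsGaussianWith [MeasurableSpace H] [BorelSpace H] (m : H) (B : H →L[ℝ] H) (μ : Measure H) :
    Prop :=
  IsGaussian μ ∧ ∫ x, x ∂μ = m ∧ ∀ u v, covarianceBilin μ u v = ⟪B u, v⟫

open Classical in
/-- The Gaussian measure `𝒩(m, B)`. On a separable Hilbert space it exists and is unique for every
positive self-adjoint trace class `B`; in particular `𝒩(m, 0)` is the Dirac mass at `m`. -/
def gaussianMeasure [MeasurableSpace H] [BorelSpace H] (m : H) (B : H →L[ℝ] H) : Measure H :=
  if h : ∃ μ : Measure H, IsGaussianWith m B μ then h.choose else 0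

/-- `T_t f(x) = ∫_H f(z) 𝒩(e^{tA} x, Q_t)(dz)`. -/
def ouT [CompleteSpace H] [MeasurableSpace H] [BorelSpace H] (S : C0Semigroup H) (Q : H →L[ℝ] H)
    (t : ℝ≥0) (f : H → ℝ) (x : H) : ℝ :=
  ∫ z, f z ∂(gaussianMeasure (S.op t x) (covOp S Q t))

/-! ### The half-space -/

/-- `H₊ = {x : ⟪x, y⟫ > 0}`. -/
def openHalf (y : H) : Set H := {x | 0 < ⟪x, y⟫}

/-- `H̄₊ = {x : ⟪x, y⟫ ≥ 0}`. -/
def closedHalf (y : H) : Set H := {x | 0 ≤ ⟪x, y⟫}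

/-- The reflection `(x₁, x') ↦ (-x₁, x')` across the hyperplane orthogonal to `y`. -/
def reflect (y x : H) : H := (ℝ ∙ y)ᗮ.reflection x

theorem inner_reflect (y x : H) : ⟪reflect y x, y⟫ = -⟪x, y⟫ := by
  have h : (ℝ ∙ y)ᗮ.reflection y = -y :=
    Submodule.reflection_orthogonalComplement_singleton_eq_neg y
  have h2 : ⟪reflect y x, -y⟫ = ⟪x, y⟫ := by
    rw [← h]
    exact LinearIsometryEquiv.inner_map_map _ x y
  rw [inner_neg_right] at h2
  linarith

open Classical in
/-- The odd extension `E η` of a function on the closed half-space: `η(x₁, x')` if `x₁ ≥ 0` and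
`-η(-x₁, x')` if `x₁ < 0`. -/
def extClosed (y : H) (η : closedHalf y → ℝ) (x : H) : ℝ :=
  if h : 0 ≤ ⟪x, y⟫ then η ⟨x, h⟩
  else -η ⟨reflect y x, by
    change 0 ≤ ⟪reflect y x, y⟫
    rw [inner_reflect]
    linarith⟩

open Classical in
/-- The odd extension `E η` of a function on the open half-space: `η(x₁, x')` if `x₁ > 0`, `0` if
`x₁ = 0`, and `-η(-x₁, x')` if `x₁ < 0`. -/
def extOpen (y : H) (η : openHalf y → ℝ) (x : H) : ℝ :=
  if h : 0 < ⟪x, y⟫ then η ⟨x, h⟩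
  else if h' : ⟪x, y⟫ < 0 then
    -η ⟨reflect y x, by
      change 0 < ⟪reflect y x, y⟫
      rw [inner_reflect]
      linarith⟩
  else 0

/-- The operator `P_t = R T_t E` on functions on the closed half-space, where `R` is the
restriction from `H` to the closed half-space. -/
def P [CompleteSpace H] [MeasurableSpace H] [BorelSpace H] (S : C0Semigroup H) (Q : H →L[ℝ] H)
    (y : H) (t : ℝ≥0) (η : closedHalf y → ℝ) : closedHalf y → ℝ :=
  (closedHalf y).domRestrict (ouT S Q t (extClosed y η))

/-- The operator `P_t = R T_t E` on functions on the open half-space; its values are functions on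
the closed half-space. -/
def POpen [CompleteSpace H] [MeasurableSpace H] [BorelSpace H] (S : C0Semigroup H) (Q : H →L[ℝ] H)
    (y : H) (t : ℝ≥0) (η : openHalf y → ℝ) : closedHalf y → ℝ :=
  (closedHalf y).domRestrict (ouT S Q t (extOpen y η))

/-! ### Function spaces -/

/-- `B_b(X)`: bounded measurable real functions on `X`. -/
def Bb (X : Type*) [MeasurableSpace X] : Submodule ℝ (X → ℝ) where
  carrier := {f | Measurable f ∧ ∃ C : ℝ, ∀ x, |f x| ≤ C}
  zero_mem' := ⟨measurable_const, 0, fun x => by simp⟩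
  add_mem' := by
    rintro f g ⟨hf, C, hC⟩ ⟨hg, D, hD⟩
    exact ⟨hf.add hg, C + D, fun x => (abs_add_le _ _).trans (add_le_add (hC x) (hD x))⟩
  smul_mem' := by
    rintro c f ⟨hf, C, hC⟩
    refine ⟨hf.const_smul c, |c| * C, fun x => ?_⟩
    rw [Pi.smul_apply, smul_eq_mul, abs_mul]
    exact mul_le_mul_of_nonneg_left (hC x) (abs_nonneg c)

/-- The supremum norm (used for bounded functions only). -/
def supNorm {X : Type*} (f : X → ℝ) : ℝ := ⨆ x, |f x|

/-- `C₀(H̄₊)`: bounded continuous functions on the closed half-space which vanish on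
`∂H₊ = {x : ⟪x, y⟫ = 0}`. -/
def C0 (y : H) : Set (closedHalf y → ℝ) :=
  {f | Continuous f ∧ (∃ C : ℝ, ∀ x, |f x| ≤ C) ∧ ∀ x : closedHalf y, ⟪(x : H), y⟫ = 0 → f x = 0}

/-- `UC₀(H̄₊)`: bounded uniformly continuous functions on the closed half-space which vanish on
`∂H₊ = {x : ⟪x, y⟫ = 0}`. -/
def UC0 (y : H) : Set (closedHalf y → ℝ) :=
  {f | UniformContinuous f ∧ (∃ C : ℝ, ∀ x, |f x| ≤ C) ∧ ∀ x : closedHalf y, ⟪(x : H), y⟫ = 0 → f x = 0}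

/-- The family `(F_t)_{t ≥ 0}` is a semigroup of (linear) contractions on `B_b(X)`, endowed with
the supremum norm. -/
structure IsContractionSemigroup {X : Type*} [MeasurableSpace X]
    (F : ℝ≥0 → (X → ℝ) → X → ℝ) : Prop where
  mem : ∀ t, ∀ f ∈ Bb X, F t f ∈ Bb X
  map_add : ∀ t, ∀ f ∈ Bb X, ∀ g ∈ Bb X, F t (f + g) = F t f + F t g
  map_smul : ∀ t, ∀ c : ℝ, ∀ f ∈ Bb X, F t (c • f) = c • F t f
  contraction : ∀ t, ∀ f ∈ Bb X, supNorm (F t f) ≤ supNorm f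
  zero : ∀ f ∈ Bb X, F 0 f = f
  add : ∀ s t, ∀ f ∈ Bb X, F (s + t) f = F s (F t f)

end

end HalfSpaceOU

/-!
Everything is computed on the whole space, where `T_t f(x) = ∫ f(e^{tA} x + z) N_t(dz)` with
`N_t = 𝒩(0, Q_t)`, and transferred to the half-space by a symmetry argument.

*Existence and calculus of `𝒩(m, B)`.* If `L` is Hilbert–Schmidt and `(e_i)` is a Hilbert basis, the
series `∑ ξ_i L e_i` with independent standard Gaussian `ξ_i` converges in `L²` to a vector with
covariance `L L*` (`exists_isGaussianWith`). The positive square root of `Q_t` is Hilbert–Schmidt,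
because the partial traces of `Q_t` are bounded in terms of the trace norm of `Q`
(`sum_inner_covOp_le`). Since a Gaussian measure is determined by its characteristic function, laws
are identified by comparing mean and covariance. In particular the cocycle identity
`Q_{s+t} = Q_s + e^{sA} Q_t e^{sA*}` gives `N_{s+t} = N_s * (e^{sA})_# N_t`, hence `T_{s+t} = T_s T_t`.

*Symmetry.* From `A y = α y` and `A* y = α y` one gets `e^{tA} y = e^{αt} y` and
`⟪e^{tA} x, y⟫ = e^{αt} ⟪x, y⟫`; the second uses that the generator is densely defined. With
`Q y = l y`, the reflection across `y^⊥` commutes with `e^{tA}` and preserves `N_t`, so `T_t` maps odd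
functions to odd functions. The odd extension of a function on the closed half-space may fail to be
odd on the boundary hyperplane, but for `t > 0` this hyperplane is null for the transition laws, as
`⟪Q_t y, y⟫ > 0`. So `T_t E η` is odd everywhere, it vanishes on the boundary, and
`E P_t η = T_t E η` (`StandingHypothesis.extClosed_P`). The semigroup law of `P_t` follows from that
of `T_t`.

*Smoothing.* Splitting `𝒩(0, R²)` into an independent sum along `R g` reduces the total variation
distance between this measure and its translate by `R g` to a one-dimensional computation, with the
bound `√(exp ‖g‖² - 1)` (`abs_integral_shift_sub_le`). The open mapping theorem turns
`im e^{tA} ⊆ im Q_t^{1/2}` into `e^{tA} x = Q_t^{1/2} g` with `‖g‖ ≤ C ‖x‖`, so `T_t f` is uniformly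
continuous for every bounded measurable `f`.

*Continuity in time.* The splitting of `N_{s+r}` couples the transition laws at the times `s` and
`s + r` with an error whose first moment is `O(√r)`. Integrals of bounded Lipschitz functions therefore
depend continuously on time, and by the portmanteau theorem so do those of bounded continuous
functions, such as the odd extension of a continuous function that vanishes on the boundary.
-/

namespace HalfSpaceOU

/-! ### Gaussian measures through their characteristic functions -/

section

variable {H : Type*} [NormedAddCommGroup H] [InnerProductSpace ℝ H] [MeasurableSpace H]
  [BorelSpace H]

theorem IsGaussianWith.isProbabilityMeasure {m : H} {B : H →L[ℝ] H} {μ : Measure H}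
    (h : IsGaussianWith m B μ) : IsProbabilityMeasure μ :=
  have := h.1
  inferInstance

/-- A covariance operator is automatically positive, so no positivity has to be carried along in
the convolution and image lemmas below. -/
theorem IsGaussianWith.isPositive {m : H} {B : H →L[ℝ] H} {μ : Measure H}
    (h : IsGaussianWith m B μ) : B.IsPositive := by
  refine ⟨fun u v => ?_, fun u => ?_⟩
  · change ⟪B u, v⟫ = ⟪u, B v⟫
    rw [← h.2.2, covarianceBilin_comm, h.2.2, real_inner_comm]
  · change 0 ≤ ⟪B u, u⟫
    rw [← h.2.2]
    exact covarianceBilin_self_nonneg u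

variable [CompleteSpace H] [SecondCountableTopology H]

theorem IsGaussianWith.charFun_eq {m : H} {B : H →L[ℝ] H} {μ : Measure H}
    (h : IsGaussianWith m B μ) (t : H) :
    charFun μ t = Complex.exp (⟪t, m⟫ * Complex.I - ⟪B t, t⟫ / 2) := by
  have := h.1
  rw [IsGaussian.charFun_eq', h.2.2]
  simp only [id_eq]
  rw [h.2.1]

/-- Gaussian measures are recognized by their characteristic function. -/
theorem isGaussianWith_of_charFun {m : H} {B : H →L[ℝ] H} {μ : Measure H}
    [IsProbabilityMeasure μ] (hB : B.IsPositive)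
    (h : ∀ t, charFun μ t = Complex.exp (⟪t, m⟫ * Complex.I - ⟪B t, t⟫ / 2)) :
    IsGaussianWith m B μ := by
  let f : H →L[ℝ] H →L[ℝ] ℝ := (innerSL ℝ).comp B
  have hf : f.toBilinForm.IsPosSemidef := by
    refine ⟨⟨fun x y => ?_⟩, ⟨fun x => ?_⟩⟩
    · change ⟪B x, y⟫ = ⟪B y, x⟫
      rw [real_inner_comm]
      exact (hB.isSymmetric y x).symm
    · exact hB.2 x
  have hf' : ∀ t, charFun μ t = Complex.exp (⟪t, m⟫ * Complex.I - f t t / 2) := h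
  have := gaussian_charFun_congr m f hf hf'
  refine ⟨isGaussian_iff_gaussian_charFun.2 ⟨m, f, hf, hf'⟩, this.1.symm, fun u v => ?_⟩
  rw [← this.2]
  rfl

theorem IsGaussianWith.unique {m : H} {B : H →L[ℝ] H} {μ ν : Measure H}
    (h : IsGaussianWith m B μ) (h' : IsGaussianWith m B ν) : μ = ν := by
  have := h.isProbabilityMeasure
  have := h'.isProbabilityMeasure
  refine Measure.ext_of_charFun (funext fun t => ?_)
  rw [h.charFun_eq, h'.charFun_eq]

theorem IsGaussianWith.gaussianMeasure_eq {m : H} {B : H →L[ℝ] H} {μ : Measure H}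
    (h : IsGaussianWith m B μ) : gaussianMeasure m B = μ := by
  have hex : ∃ μ : Measure H, IsGaussianWith m B μ := ⟨μ, h⟩
  rw [gaussianMeasure, dif_pos hex]
  exact hex.choose_spec.unique h

theorem isGaussianWith_dirac (m : H) : IsGaussianWith m 0 (Measure.dirac m) := by
  refine isGaussianWith_of_charFun ContinuousLinearMap.isPositive_zero fun t => ?_
  rw [charFun_dirac]
  simp [real_inner_comm]

theorem IsGaussianWith.conv {m m' : H} {B B' : H →L[ℝ] H} {μ ν : Measure H}
    (h : IsGaussianWith m B μ) (h' : IsGaussianWith m' B' ν) :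
    IsGaussianWith (m + m') (B + B') (μ.conv ν) := by
  have := h.isProbabilityMeasure
  have := h'.isProbabilityMeasure
  refine isGaussianWith_of_charFun (h.isPositive.add h'.isPositive) fun t => ?_
  rw [charFun_conv, h.charFun_eq, h'.charFun_eq, ← Complex.exp_add, inner_add_right,
    add_apply, inner_add_left]
  push_cast
  ring_nf

theorem IsGaussianWith.map {m : H} {B : H →L[ℝ] H} {μ : Measure H}
    (h : IsGaussianWith m B μ) (L : H →L[ℝ] H) :
    IsGaussianWith (L m) (L ∘L B ∘L L.adjoint) (μ.map L) := by
  have := h.isProbabilityMeasure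
  have : IsProbabilityMeasure (μ.map L) := Measure.isProbabilityMeasure_map (by fun_prop)
  refine isGaussianWith_of_charFun (h.isPositive.conj_adjoint L) fun t => ?_
  have : charFun (μ.map L) t = charFun μ (L.adjoint t) := by
    rw [charFun_apply, charFun_apply, integral_map (by fun_prop) (by fun_prop)]
    simp_rw [ContinuousLinearMap.adjoint_inner_right]
  rw [this, h.charFun_eq, ContinuousLinearMap.adjoint_inner_left,
    ContinuousLinearMap.adjoint_inner_right]
  rfl

theorem IsGaussianWith.map_const_add {m : H} {B : H →L[ℝ] H} {μ : Measure H}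
    (h : IsGaussianWith m B μ) (a : H) :
    IsGaussianWith (a + m) B (μ.map (a + ·)) := by
  have := h.isProbabilityMeasure
  have : IsProbabilityMeasure (μ.map (a + ·)) := Measure.isProbabilityMeasure_map (by fun_prop)
  refine isGaussianWith_of_charFun h.isPositive fun t => ?_
  rw [charFun_map_const_add, h.charFun_eq, ← Complex.exp_add, inner_add_right,
    real_inner_comm t a]
  push_cast
  ring_nf

/-- A Gaussian measure does not charge a hyperplane `⟪·, u⟫ = 0` along whose normal direction its
covariance is nonzero. -/
theorem IsGaussianWith.measure_inner_eq_zero {m : H} {B : H →L[ℝ] H} {μ : Measure H}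
    (h : IsGaussianWith m B μ) {u : H} (hu : ⟪B u, u⟫ ≠ 0) : μ {x | ⟪x, u⟫ = 0} = 0 := by
  have := h.1
  have h1 := IsGaussian.map_eq_gaussianReal (μ := μ) (innerSL ℝ u)
  have hv : Var[innerSL ℝ u; μ] ≠ 0 := by
    have : Var[innerSL ℝ u; μ] = ⟪B u, u⟫ := by
      rw [← h.2.2, covarianceBilin_self IsGaussian.memLp_two_id]
      rfl
    rwa [this]
  have : NullSingletonClass (μ.map (innerSL ℝ u)) := by
    rw [h1]
    refine nullSingletonClass_gaussianReal fun h0 => hv ?_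
    exact le_antisymm (Real.toNNReal_eq_zero.1 h0) (variance_nonneg _ _)
  have h2 := measure_singleton (μ := μ.map (innerSL ℝ u)) (0 : ℝ)
  rw [Measure.map_apply (by fun_prop) (measurableSet_singleton _)] at h2
  convert h2 using 2
  ext x
  simp [real_inner_comm]

end

/-! ### Existence of Gaussian measures with Hilbert–Schmidt factor -/

section

/-- The law of a family of independent standard Gaussian real variables indexed by `ι`. -/
noncomputable abbrev whiteNoise (ι : Type*) : Measure (ι → ℝ) :=
  Measure.infinitePi fun _ : ι => gaussianReal 0 1

theorem memLp_whiteNoise_coord {ι : Type*} (i : ι) :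
    MemLp (fun ω : ι → ℝ => ω i) 2 (whiteNoise ι) := by
  have h := Measure.infinitePi_map_eval (fun _ : ι => gaussianReal 0 1) i
  have h2 : MemLp id 2 ((whiteNoise ι).map (fun ω => ω i)) := by
    rw [show (whiteNoise ι).map (fun ω => ω i) = gaussianReal 0 1 from h]
    exact memLp_id_gaussianReal 2
  exact h2.comp_of_map (measurable_pi_apply i).aemeasurable

theorem integral_whiteNoise_coord {ι : Type*} (i : ι) (f : ℝ → ℝ) (hf : Measurable f) :
    ∫ ω : ι → ℝ, f (ω i) ∂(whiteNoise ι) = ∫ x, f x ∂(gaussianReal 0 1) := by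
  have h := Measure.infinitePi_map_eval (fun _ : ι => gaussianReal 0 1) i
  rw [← h, integral_map (measurable_pi_apply i).aemeasurable hf.aestronglyMeasurable]

theorem integral_whiteNoise_mul {ι : Type*} [DecidableEq ι] (i j : ι) :
    ∫ ω : ι → ℝ, ω i * ω j ∂(whiteNoise ι) = if i = j then 1 else 0 := by
  split_ifs with hij
  · subst hij
    have := integral_whiteNoise_coord i (fun x => x * x) (by fun_prop)
    rw [this]
    have h2 := variance_id_gaussianReal (μ := 0) (v := 1)
    rw [variance_eq_integral (by fun_prop)] at h2
    simpa [pow_two] using h2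
  · have h := (iIndepFun_infinitePi (P := fun _ : ι => gaussianReal 0 1)
      (X := fun _ x => x) (fun _ => measurable_id)).indepFun hij
    rw [h.integral_fun_mul_eq_mul_integral (measurable_pi_apply i).aestronglyMeasurable
        (measurable_pi_apply j).aestronglyMeasurable,
      integral_whiteNoise_coord i (fun x => x) (by fun_prop)]
    simp


variable {H : Type*} [NormedAddCommGroup H] [InnerProductSpace ℝ H]

theorem memLp_noise_smul {ι : Type*} (i : ι) (h : H) :
    MemLp (fun ω : ι → ℝ => ω i • h) 2 (whiteNoise ι) :=
  (memLp_top_const h).smul (memLp_whiteNoise_coord i)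

/-- Two square-integrable random vectors which are close in `L²` have characteristic functions
which are close. -/
theorem norm_integral_exp_sub_le {Ω : Type*} [MeasurableSpace Ω] {P : Measure Ω}
    [IsProbabilityMeasure P] (X Y : Lp H 2 P) (t : H) :
    ‖∫ ω, Complex.exp ((⟪X ω, t⟫ : ℂ) * Complex.I) ∂P
      - ∫ ω, Complex.exp ((⟪Y ω, t⟫ : ℂ) * Complex.I) ∂P‖ ≤ ‖X - Y‖ * ‖t‖ := by
  have hint : ∀ Z : Lp H 2 P, Integrable (fun ω => Complex.exp ((⟪Z ω, t⟫ : ℂ) * Complex.I)) P := by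
    intro Z
    have hZ : AEStronglyMeasurable (fun ω => ⟪Z ω, t⟫) P :=
      (Lp.aestronglyMeasurable Z).inner aestronglyMeasurable_const
    refine Integrable.of_bound (C := 1) ?_ (ae_of_all _ fun ω => ?_)
    · exact (by fun_prop : Continuous fun r : ℝ =>
        Complex.exp ((r : ℂ) * Complex.I)).comp_aestronglyMeasurable hZ
    · rw [Complex.norm_exp_ofReal_mul_I]
  have hL : MemLp (fun ω => X ω - Y ω) 2 P := (Lp.memLp X).sub (Lp.memLp Y)
  have hL1 : Integrable (fun ω => X ω - Y ω) P := hL.integrable (by norm_num)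
  have hle : ∫ ω, ‖X ω - Y ω‖ ∂P ≤ ‖X - Y‖ := by
    rw [integral_norm_eq_lintegral_enorm hL1.1, ← eLpNorm_one_eq_lintegral_enorm, Lp.norm_def]
    refine ENNReal.toReal_mono (Lp.eLpNorm_ne_top _) ?_
    rw [eLpNorm_congr_ae (Lp.coeFn_sub X Y)]
    exact eLpNorm_le_eLpNorm_of_exponent_le (by norm_num) hL.1
  rw [← integral_sub (hint X) (hint Y)]
  refine (norm_integral_le_integral_norm _).trans ?_
  calc ∫ ω, ‖Complex.exp ((⟪X ω, t⟫ : ℂ) * Complex.I)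
        - Complex.exp ((⟪Y ω, t⟫ : ℂ) * Complex.I)‖ ∂P
      ≤ ∫ ω, ‖X ω - Y ω‖ * ‖t‖ ∂P := by
        refine integral_mono ((hint X).sub (hint Y)).norm (hL1.norm.mul_const _) fun ω => ?_
        have h1 : Complex.exp ((⟪X ω, t⟫ : ℂ) * Complex.I)
            - Complex.exp ((⟪Y ω, t⟫ : ℂ) * Complex.I)
            = Complex.exp ((⟪Y ω, t⟫ : ℂ) * Complex.I) *
              (Complex.exp (Complex.I * ((⟪X ω - Y ω, t⟫ : ℝ) : ℂ)) - 1) := by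
          rw [mul_sub, ← Complex.exp_add, inner_sub_left]
          push_cast
          ring_nf
        simp only
        rw [h1, norm_mul, Complex.norm_exp_ofReal_mul_I, one_mul]
        exact Real.norm_exp_I_mul_ofReal_sub_one_le.trans (norm_inner_le_norm _ _)
    _ = (∫ ω, ‖X ω - Y ω‖ ∂P) * ‖t‖ := integral_mul_const _ _
    _ ≤ ‖X - Y‖ * ‖t‖ := by gcongr

/-- The square-integrable random vector `ξ_i h`, where `ξ_i` is the `i`-th coordinate of the white
noise and `h` is a fixed vector. -/
noncomputable def noiseVec {ι : Type*} (i : ι) (h : H) : Lp H 2 (whiteNoise ι) :=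
  (memLp_noise_smul i h).toLp

theorem inner_noiseVec {ι : Type*} [DecidableEq ι] (i j : ι) (h k : H) :
    ⟪noiseVec i h, noiseVec j k⟫ = if i = j then ⟪h, k⟫ else 0 := by
  have h1 : ∫ ω, ⟪noiseVec i h ω, noiseVec j k ω⟫ ∂(whiteNoise ι)
      = ∫ ω : ι → ℝ, ω i * ω j * ⟪h, k⟫ ∂(whiteNoise ι) := by
    refine integral_congr_ae ?_
    filter_upwards [(memLp_noise_smul i h).coeFn_toLp, (memLp_noise_smul j k).coeFn_toLp]
      with ω h1 h2
    rw [noiseVec, noiseVec, h1, h2, real_inner_smul_left, real_inner_smul_right, mul_assoc]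
  rw [L2.inner_def, h1, integral_mul_const, integral_whiteNoise_mul]
  split_ifs <;> simp

/-- The isometric embedding `h ↦ ξ_i h` of `H` into the space of square-integrable `H`-valued
random variables, where `ξ_i` is the `i`-th coordinate of the white noise. -/
noncomputable def noiseEmbedding {ι : Type*} (i : ι) : H →ₗᵢ[ℝ] Lp H 2 (whiteNoise ι) where
  toFun h := noiseVec i h
  map_add' h k := by
    simp only [noiseVec]
    rw [← MemLp.toLp_add]
    congr 1
    ext ω
    simp
  map_smul' c h := by
    simp only [noiseVec]
    rw [RingHom.id_apply, ← MemLp.toLp_const_smul]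
    congr 1
    ext ω
    simp [smul_comm c]
  norm_map' h := by
    classical
    change ‖noiseVec i h‖ = ‖h‖
    rw [@norm_eq_sqrt_real_inner _ _ _ (noiseVec i h), inner_noiseVec, if_pos rfl,
      norm_eq_sqrt_real_inner]

theorem orthogonalFamily_noiseEmbedding (ι : Type*) :
    OrthogonalFamily ℝ (fun _ : ι => H) (fun i => noiseEmbedding (H := H) i) := by
  classical
  intro i j hij h k
  change ⟪noiseVec i h, noiseVec j k⟫ = 0
  rw [inner_noiseVec, if_neg hij]

theorem noiseVec_sum_ae {ι : Type*} (F : Finset ι) (v : ι → H) :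
    (∑ i ∈ F, noiseEmbedding i (v i) : Lp H 2 (whiteNoise ι)) =ᵐ[whiteNoise ι]
      fun ω => ∑ i ∈ F, ω i • v i := by
  have h1 : ∀ᵐ ω ∂(whiteNoise ι), ∀ i ∈ F, noiseVec i (v i) ω = ω i • v i :=
    (Finset.eventually_all F).2 fun i _ => (memLp_noise_smul i (v i)).coeFn_toLp
  have h2 := Lp.coeFn_finsetSum F (fun i => noiseVec i (v i))
  filter_upwards [h1, h2] with ω h1 h2
  change (∑ i ∈ F, noiseVec i (v i) : Lp H 2 (whiteNoise ι)) ω = _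
  rw [h2, Finset.sum_apply]
  exact Finset.sum_congr rfl h1

/-- The characteristic function of a finite sum `∑ ξ_i v_i`. -/
theorem integral_exp_noise_sum {ι : Type*} (F : Finset ι) (c : ι → ℝ) :
    ∫ ω : ι → ℝ, Complex.exp (((∑ i ∈ F, ω i * c i : ℝ) : ℂ) * Complex.I) ∂(whiteNoise ι)
      = Complex.exp (-((∑ i ∈ F, c i ^ 2 : ℝ) : ℂ) / 2) := by
  have hind : iIndepFun (fun i (ω : ι → ℝ) => ω i * c i) (whiteNoise ι) :=
    iIndepFun_infinitePi (P := fun _ : ι => gaussianReal 0 1)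
      (X := fun i x => x * c i) (fun i => by fun_prop)
  have hm : ∀ i, Measurable fun (ω : ι → ℝ) => ω i * c i := fun i =>
    (measurable_pi_apply i).mul_const _
  have h := congrFun ((hind.restrict F).charFun_map_fun_finsetSum_eq_prod
    fun i _ => (hm i).aemeasurable) 1
  have hi : ∀ i ∈ F, charFun ((whiteNoise ι).map fun ω => ω i * c i) 1
      = Complex.exp (-((c i ^ 2 : ℝ) : ℂ) / 2) := by
    intro i _
    have h1 := charFun_map_mul_comp (μ := whiteNoise ι) (f := fun ω => ω i)
      (measurable_pi_apply i).aemeasurable (c i) 1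
    have h2 := Measure.infinitePi_map_eval (fun _ : ι => gaussianReal 0 1) i
    simp_rw [mul_comm _ (c i)]
    rw [h1, mul_one, show (whiteNoise ι).map (fun ω => ω i) = gaussianReal 0 1 from h2,
      charFun_gaussianReal]
    congr 1
    push_cast
    ring
  rw [Finset.prod_apply, Finset.prod_congr rfl hi, ← Complex.exp_sum, charFun_apply,
    integral_map (Finset.measurable_fun_sum F fun i _ => hm i).aemeasurable (by fun_prop)] at h
  convert h using 2
  · ext ω
    simp
  · push_cast
    rw [← Finset.sum_div, Finset.sum_neg_distrib]

variable [CompleteSpace H] [SecondCountableTopology H] [MeasurableSpace H] [BorelSpace H]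

/-- If `L` is a Hilbert–Schmidt operator, there is a centered Gaussian measure with covariance
operator `L L*`; its first absolute moment is at most the Hilbert–Schmidt norm of `L`. -/
theorem exists_isGaussianWith {ι : Type*} (e : HilbertBasis ι ℝ H) (L : H →L[ℝ] H) {C : ℝ}
    (hC : ∀ F : Finset ι, ∑ i ∈ F, ‖L (e i)‖ ^ 2 ≤ C) :
    ∃ μ : Measure H, IsGaussianWith 0 (L ∘L L.adjoint) μ ∧ ∫ x, ‖x‖ ∂μ ≤ √C := by
  have hsum : Summable fun i => ‖L (e i)‖ ^ 2 :=
    summable_of_sum_le (fun i => sq_nonneg _) hC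
  have hO := orthogonalFamily_noiseEmbedding (H := H) ι
  obtain ⟨X, hX⟩ := (hO.summable_iff_norm_sq_summable fun i => L (e i)).2 hsum
  have hXn : ‖X‖ ≤ √C := by
    refine le_of_tendsto hX.norm (Eventually.of_forall fun F => ?_)
    refine Real.le_sqrt_of_sq_le ?_
    rw [hO.norm_sum]
    exact hC F
  have hXm : AEMeasurable X (whiteNoise ι) := (Lp.aestronglyMeasurable X).aemeasurable
  have : IsProbabilityMeasure ((whiteNoise ι).map X) := Measure.isProbabilityMeasure_map hXm
  refine ⟨(whiteNoise ι).map X, isGaussianWith_of_charFun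
    (ContinuousLinearMap.isPositive_self_comp_adjoint L) fun t => ?_, ?_⟩
  · rw [charFun_apply, integral_map hXm (by fun_prop)]
    have h1 : Tendsto (fun F : Finset ι => ∫ ω, Complex.exp ((⟪(∑ i ∈ F,
        noiseEmbedding i (L (e i)) : Lp H 2 (whiteNoise ι)) ω, t⟫ : ℂ) * Complex.I)
          ∂(whiteNoise ι)) atTop
        (𝓝 (∫ ω, Complex.exp ((⟪X ω, t⟫ : ℂ) * Complex.I) ∂(whiteNoise ι))) := by
      rw [tendsto_iff_norm_sub_tendsto_zero]
      refine squeeze_zero (fun _ => norm_nonneg _)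
        (fun F => norm_integral_exp_sub_le _ _ t) ?_
      have h2 := (tendsto_iff_norm_sub_tendsto_zero.1 hX).mul_const ‖t‖
      rwa [zero_mul] at h2
    have h2 : ∀ F : Finset ι, ∫ ω, Complex.exp ((⟪(∑ i ∈ F,
        noiseEmbedding i (L (e i)) : Lp H 2 (whiteNoise ι)) ω, t⟫ : ℂ) * Complex.I)
          ∂(whiteNoise ι) = Complex.exp (-((∑ i ∈ F, ⟪L (e i), t⟫ ^ 2 : ℝ) : ℂ) / 2) := by
      intro F
      rw [← integral_exp_noise_sum]
      refine integral_congr_ae ?_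
      filter_upwards [noiseVec_sum_ae F fun i => L (e i)] with ω hω
      rw [hω, sum_inner]
      simp_rw [real_inner_smul_left]
    simp_rw [h2] at h1
    refine tendsto_nhds_unique h1 ?_
    have h3 : HasSum (fun i => ⟪L (e i), t⟫ ^ 2) ⟪(L ∘L L.adjoint) t, t⟫ := by
      have h4 := e.hasSum_inner_mul_inner (L.adjoint t) (L.adjoint t)
      rw [ContinuousLinearMap.comp_apply, ← ContinuousLinearMap.adjoint_inner_right]
      refine h4.congr_fun fun i => ?_
      rw [ContinuousLinearMap.adjoint_inner_left, ContinuousLinearMap.adjoint_inner_right,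
        real_inner_comm t, pow_two]
    have h4 : Continuous fun r : ℝ => Complex.exp (-(r : ℂ) / 2) := by fun_prop
    have h5 := (h4.tendsto _).comp h3
    simpa [neg_div, Function.comp_def] using h5
  · rw [integral_map hXm (by fun_prop)]
    refine le_trans ?_ hXn
    have hL1 : Integrable X (whiteNoise ι) := (Lp.memLp X).integrable (by norm_num)
    rw [integral_norm_eq_lintegral_enorm hL1.1, ← eLpNorm_one_eq_lintegral_enorm, Lp.norm_def]
    exact ENNReal.toReal_mono (Lp.eLpNorm_ne_top _)
      (eLpNorm_le_eLpNorm_of_exponent_le (by norm_num) hL1.1)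

end

/-! ### Translates of a Gaussian measure along the range of the square root of its covariance -/

section

theorem integral_sq_exp_sub_one_gaussianReal (a : ℝ) :
    Integrable (fun x => (Real.exp (a * x - a ^ 2 / 2) - 1) ^ 2) (gaussianReal 0 1) ∧
    ∫ x, (Real.exp (a * x - a ^ 2 / 2) - 1) ^ 2 ∂(gaussianReal 0 1) = Real.exp (a ^ 2) - 1 := by
  have h1 : ∀ b : ℝ, ∫ x, Real.exp (b * x) ∂(gaussianReal 0 1) = Real.exp (b ^ 2 / 2) := by
    intro b
    have := congrFun (mgf_id_gaussianReal (μ := 0) (v := 1)) b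
    simpa [mgf] using this
  have hi : ∀ b : ℝ, Integrable (fun x => Real.exp (b * x)) (gaussianReal 0 1) :=
    fun b => integrable_exp_mul_gaussianReal b
  have he : (fun x => (Real.exp (a * x - a ^ 2 / 2) - 1) ^ 2) = fun x =>
      Real.exp (-a ^ 2) * Real.exp ((2 * a) * x) - 2 * Real.exp (-a ^ 2 / 2) * Real.exp (a * x)
        + 1 := by
    ext x
    have e1 : Real.exp (-a ^ 2) * Real.exp ((2 * a) * x) = Real.exp (a * x - a ^ 2 / 2) ^ 2 := by
      rw [← Real.exp_add, ← Real.exp_nat_mul]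
      congr 1
      push_cast
      ring
    have e2 : Real.exp (-a ^ 2 / 2) * Real.exp (a * x) = Real.exp (a * x - a ^ 2 / 2) := by
      rw [← Real.exp_add]
      congr 1
      ring
    rw [e1, mul_assoc, e2]
    ring
  have i1 := (hi (2 * a)).const_mul (Real.exp (-a ^ 2))
  have i2 := (hi a).const_mul (2 * Real.exp (-a ^ 2 / 2))
  rw [he]
  have i3 : Integrable (fun x => Real.exp (-a ^ 2) * Real.exp ((2 * a) * x)
      - 2 * Real.exp (-a ^ 2 / 2) * Real.exp (a * x)) (gaussianReal 0 1) := i1.sub i2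
  refine ⟨i3.add (integrable_const 1), ?_⟩
  rw [integral_add i3 (integrable_const 1), integral_sub i1 i2, integral_const_mul,
    integral_const_mul, h1, h1, ← Real.exp_add, mul_assoc, ← Real.exp_add]
  have e1 : -a ^ 2 + (2 * a) ^ 2 / 2 = a ^ 2 := by ring
  have e2 : -a ^ 2 / 2 + a ^ 2 / 2 = 0 := by ring
  rw [e1, e2]
  simp
  ring

/-- The total variation distance between the standard Gaussian law and its translate by `a` tends
to `0` as `a → 0`, at an explicit rate. -/
theorem abs_integral_gaussianReal_shift_sub_le {φ : ℝ → ℝ} (hφ : Measurable φ) {M : ℝ}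
    (hM : ∀ x, |φ x| ≤ M) (a : ℝ) :
    |∫ x, φ (x + a) ∂(gaussianReal 0 1) - ∫ x, φ x ∂(gaussianReal 0 1)|
      ≤ M * √(Real.exp (a ^ 2) - 1) := by
  have hM0 : 0 ≤ M := (abs_nonneg _).trans (hM 0)
  set g : ℝ → ℝ := fun x => Real.exp (a * x - a ^ 2 / 2) - 1 with hg
  obtain ⟨hi2, hI2⟩ := integral_sq_exp_sub_one_gaussianReal a
  have hgm : Measurable g := by fun_prop
  have hgL : MemLp g 2 (gaussianReal 0 1) :=
    (memLp_two_iff_integrable_sq hgm.aestronglyMeasurable).2 hi2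
  have hgi : Integrable g (gaussianReal 0 1) := hgL.integrable (by norm_num)
  have hφi : ∀ m, Integrable φ (gaussianReal m 1) := fun m =>
    Integrable.of_bound hφ.aestronglyMeasurable M (ae_of_all _ fun x => hM x)
  have hφg : Integrable (fun x => g x * φ x) (gaussianReal 0 1) :=
    hgi.mul_bdd hφ.aestronglyMeasurable (ae_of_all _ fun x => hM x)
  have h1 : ∫ x, φ (x + a) ∂(gaussianReal 0 1) = ∫ x, φ x ∂(gaussianReal a 1) := by
    have h := gaussianReal_map_add_const (μ := 0) (v := 1) a
    rw [zero_add] at h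
    rw [← h, integral_map (by fun_prop) hφ.aestronglyMeasurable]
  -- `g + 1` is the density of the translated law
  have h2 : ∫ x, φ x ∂(gaussianReal a 1) = ∫ x, (g x + 1) * φ x ∂(gaussianReal 0 1) := by
    rw [integral_gaussianReal_eq_integral_smul (by norm_num),
      integral_gaussianReal_eq_integral_smul (by norm_num)]
    congr 1
    ext x
    simp only [smul_eq_mul, ← mul_assoc]
    congr 1
    simp only [gaussianPDFReal, hg, sub_add_cancel, mul_assoc]
    rw [← Real.exp_add]
    congr 3
    simp
    ring
  have h3 : ∫ x, φ (x + a) ∂(gaussianReal 0 1) - ∫ x, φ x ∂(gaussianReal 0 1)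
      = ∫ x, g x * φ x ∂(gaussianReal 0 1) := by
    rw [h1, h2]
    simp_rw [add_mul, one_mul]
    rw [integral_add hφg (hφi 0), add_sub_cancel_right]
  have h4 : ∫ x, |g x| ∂(gaussianReal 0 1) ≤ √(Real.exp (a ^ 2) - 1) := by
    refine Real.le_sqrt_of_sq_le ?_
    have hv := variance_nonneg (fun x => |g x|) (gaussianReal 0 1)
    rw [variance_eq_sub (by simpa using hgL.norm)] at hv
    have : ∫ x, |g x| ^ 2 ∂(gaussianReal 0 1) = Real.exp (a ^ 2) - 1 := by
      rw [← hI2]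
      simp_rw [sq_abs, hg]
    simp only [Pi.pow_apply] at hv
    linarith
  rw [h3]
  calc |∫ x, g x * φ x ∂(gaussianReal 0 1)| ≤ ∫ x, |g x * φ x| ∂(gaussianReal 0 1) :=
        abs_integral_le_integral_abs
    _ ≤ ∫ x, |g x| * M ∂(gaussianReal 0 1) := by
        refine integral_mono hφg.abs (hgi.abs.mul_const M) fun x => ?_
        simp only [abs_mul]
        exact mul_le_mul_of_nonneg_left (hM x) (abs_nonneg _)
    _ = M * ∫ x, |g x| ∂(gaussianReal 0 1) := by rw [integral_mul_const, mul_comm]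
    _ ≤ _ := mul_le_mul_of_nonneg_left h4 hM0

variable {H : Type*} [NormedAddCommGroup H] [InnerProductSpace ℝ H] [CompleteSpace H]
  [SecondCountableTopology H] [MeasurableSpace H] [BorelSpace H]

/-- The law of `ξ v`, with `ξ` a standard Gaussian real variable. -/
theorem isGaussianWith_map_smul (v : H) :
    IsGaussianWith 0 (InnerProductSpace.rankOne ℝ v v)
      ((gaussianReal 0 1).map fun ξ : ℝ => ξ • v) := by
  have : IsProbabilityMeasure ((gaussianReal 0 1).map fun ξ : ℝ => ξ • v) :=
    Measure.isProbabilityMeasure_map (by fun_prop)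
  refine isGaussianWith_of_charFun (InnerProductSpace.isPositive_rankOne_self v) fun t => ?_
  have h : charFun ((gaussianReal 0 1).map fun ξ : ℝ => ξ • v) t
      = charFun (gaussianReal 0 1) ⟪v, t⟫ := by
    rw [charFun_apply, charFun_apply, integral_map (by fun_prop) (by fun_prop)]
    congr 1
    ext ξ
    rw [real_inner_smul_left]
    simp [mul_comm]
  rw [h, charFun_gaussianReal]
  simp [real_inner_smul_left, pow_two]

/-- A Gaussian measure with covariance `R²` and its translate by `R g` are close in total variation
when `g` is small. The measure is split as the independent sum of `ξ R e`, with `e = g / ‖g‖`, and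
of a Gaussian measure with covariance `R² - R e ⊗ R e`; the translation then only shifts `ξ`
by `‖g‖`. -/
theorem abs_integral_shift_sub_le {ι : Type*} (b : HilbertBasis ι ℝ H) {R : H →L[ℝ] H}
    (hR : R.IsPositive) {C : ℝ} (hC : ∀ F : Finset ι, ∑ i ∈ F, ‖R (b i)‖ ^ 2 ≤ C)
    {μ : Measure H} (hμ : IsGaussianWith 0 (R ∘L R) μ) {φ : H → ℝ} (hφ : Measurable φ) {M : ℝ}
    (hM : ∀ x, |φ x| ≤ M) (g : H) :
    |∫ z, φ (R g + z) ∂μ - ∫ z, φ z ∂μ| ≤ M * √(Real.exp (‖g‖ ^ 2) - 1) := by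
  rcases eq_or_ne g 0 with rfl | hg
  · simp
  have hg0 : ‖g‖ ≠ 0 := norm_ne_zero_iff.2 hg
  set e : H := ‖g‖⁻¹ • g with he
  have he1 : ‖e‖ = 1 := by rw [he, norm_smul, norm_inv, norm_norm, inv_mul_cancel₀ hg0]
  have hge : g = ‖g‖ • e := by rw [he, smul_smul, mul_inv_cancel₀ hg0, one_smul]
  -- the orthogonal projection onto the complement of `e`; `R p` carries the independent rest
  set p : H →L[ℝ] H := ContinuousLinearMap.id ℝ H - InnerProductSpace.rankOne ℝ e e with hp
  have hpx : ∀ x, p x = x - ⟪e, x⟫ • e := fun x => by simp [hp]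
  have hpadj : p.adjoint = p := by
    symm
    rw [ContinuousLinearMap.eq_adjoint_iff]
    intro x y
    rw [hpx, hpx, inner_sub_left, inner_sub_right, real_inner_smul_left, real_inner_smul_right,
      real_inner_comm e x]
    ring
  have hRadj : R.adjoint = R := hR.isSelfAdjoint.adjoint_eq
  have hLC : ∀ F : Finset ι, ∑ i ∈ F, ‖(R ∘L p) (b i)‖ ^ 2 ≤ 2 * C + 2 * ‖R e‖ ^ 2 := by
    intro F
    have h1 : ∀ i ∈ F, ‖(R ∘L p) (b i)‖ ^ 2
        ≤ 2 * ‖R (b i)‖ ^ 2 + 2 * ‖R e‖ ^ 2 * ‖⟪b i, e⟫‖ ^ 2 := by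
      intro i _
      rw [ContinuousLinearMap.comp_apply, hpx, map_sub, map_smul]
      have h2 : ‖R (b i) - ⟪e, b i⟫ • R e‖ ≤ ‖R (b i)‖ + ‖⟪b i, e⟫‖ * ‖R e‖ := by
        refine (norm_sub_le _ _).trans ?_
        rw [norm_smul, real_inner_comm]
      calc _ ≤ (‖R (b i)‖ + ‖⟪b i, e⟫‖ * ‖R e‖) ^ 2 := by gcongr
        _ ≤ _ := by nlinarith [sq_nonneg (‖R (b i)‖ - ‖⟪b i, e⟫‖ * ‖R e‖)]
    refine (Finset.sum_le_sum h1).trans ?_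
    rw [Finset.sum_add_distrib, ← Finset.mul_sum, ← Finset.mul_sum]
    have h3 := b.orthonormal.sum_inner_products_le (x := e) (s := F)
    rw [he1] at h3
    nlinarith [hC F, sq_nonneg ‖R e‖]
  obtain ⟨ν, hν, -⟩ := exists_isGaussianWith b (R ∘L p) hLC
  have hρ := isGaussianWith_map_smul (R e)
  set ρ := (gaussianReal 0 1).map fun ξ : ℝ => ξ • R e with hρd
  have hop : (R ∘L p) ∘L (R ∘L p).adjoint + InnerProductSpace.rankOne ℝ (R e) (R e)
      = R ∘L R := by
    ext x
    rw [ContinuousLinearMap.adjoint_comp, hpadj, hRadj]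
    have h1 : ⟪R e, x⟫ = ⟪e, R x⟫ := hR.inner_left_eq_inner_right e x
    simp [hpx, inner_sub_right, real_inner_smul_right, he1, h1]
  have hconv := hν.conv hρ
  rw [add_zero, hop] at hconv
  have := hν.isProbabilityMeasure
  have := hρ.isProbabilityMeasure
  have := hμ.isProbabilityMeasure
  have hb : ∀ {X : Type _} [MeasurableSpace X] (P : Measure X) [IsProbabilityMeasure P]
      (ψ : X → ℝ), Measurable ψ → (∀ x, |ψ x| ≤ M) → Integrable ψ P :=
    fun P _ ψ hψ hψM => Integrable.of_bound hψ.aestronglyMeasurable M (ae_of_all _ hψM)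
  rw [hμ.unique hconv]
  have hm1 : Measurable fun z => φ (R g + z) := by fun_prop
  rw [integral_conv (hb _ _ hm1 fun _ => hM _), integral_conv (hb _ _ hφ hM)]
  have hin : ∀ ψ : H → ℝ, Measurable ψ →
      ∀ w, ∫ y, ψ (w + y) ∂ρ = ∫ ξ, ψ (w + ξ • R e) ∂(gaussianReal 0 1) := by
    intro ψ hψ w
    have hm : Measurable fun y => ψ (w + y) := by fun_prop
    rw [hρd, integral_map (by fun_prop) hm.aestronglyMeasurable]
  have hi : ∀ ψ : H → ℝ, Measurable ψ → (∀ x, |ψ x| ≤ M) →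
      Integrable (fun w => ∫ y, ψ (w + y) ∂ρ) ν := by
    intro ψ hψ hψM
    have : Integrable (fun q : H × H => ψ (q.1 + q.2)) (ν.prod ρ) :=
      hb _ _ (by fun_prop) fun _ => hψM _
    exact this.integral_prod_left
  rw [← integral_sub (hi _ hm1 fun _ => hM _) (hi _ hφ hM)]
  have hpt : ∀ w, ‖∫ y, φ (R g + (w + y)) ∂ρ - ∫ y, φ (w + y) ∂ρ‖
      ≤ M * √(Real.exp (‖g‖ ^ 2) - 1) := by
    intro w
    rw [hin _ hm1, hin _ hφ]
    have h := abs_integral_gaussianReal_shift_sub_le (φ := fun ξ => φ (w + ξ • R e))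
      (by fun_prop) (fun _ => hM _) ‖g‖
    have hRg : R g = ‖g‖ • R e := by
      conv_lhs => rw [hge]
      rw [map_smul]
    have he : ∀ ξ : ℝ, R g + (w + ξ • R e) = w + (ξ + ‖g‖) • R e := by
      intro ξ
      rw [hRg, add_smul]
      abel
    simp_rw [he]
    exact h
  have := norm_integral_le_of_norm_le_const (μ := ν) (ae_of_all _ hpt)
  simpa using this

end

/-! ### The semigroup and the operators `Q_t` -/

section

variable {H : Type*} [NormedAddCommGroup H] [InnerProductSpace ℝ H]

theorem C0Semigroup.op_add_apply (S : C0Semigroup H) (s t : ℝ≥0) (x : H) :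
    S.op (s + t) x = S.op s (S.op t x) := by
  rw [S.op_add]
  rfl

theorem norm_rankOne_op_le {S : C0Semigroup H} {s : ℝ≥0} {M : ℝ} (hM : ‖S.op s‖ ≤ M) (a b : H) :
    ‖InnerProductSpace.rankOne ℝ (S.op s b) (S.op s a)‖ ≤ M ^ 2 * (‖a‖ * ‖b‖) := by
  have hM0 : 0 ≤ M := (norm_nonneg _).trans hM
  rw [InnerProductSpace.norm_rankOne]
  calc ‖S.op s b‖ * ‖S.op s a‖ ≤ (M * ‖b‖) * (M * ‖a‖) := by
        gcongr
        · exact (S.op s).le_of_opNorm_le hM b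
        · exact (S.op s).le_of_opNorm_le hM a
    _ = _ := by ring

theorem sum_abs_inner_mul_le {ι : Type*} (e : HilbertBasis ι ℝ H) (F : Finset ι) (x z : H) :
    ∑ i ∈ F, |⟪x, e i⟫ * ⟪z, e i⟫| ≤ ‖x‖ * ‖z‖ := by
  have hb : ∀ x : H, √(∑ i ∈ F, |⟪x, e i⟫| ^ 2) ≤ ‖x‖ := by
    intro x
    refine Real.sqrt_le_iff.2 ⟨norm_nonneg _, ?_⟩
    have := e.orthonormal.sum_inner_products_le (x := x) (s := F)
    simpa [real_inner_comm] using this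
  simp_rw [abs_mul]
  exact (Real.sum_mul_le_sqrt_mul_sqrt _ _ _).trans
    (mul_le_mul (hb x) (hb z) (Real.sqrt_nonneg _) (norm_nonneg _))

variable [CompleteSpace H]

/-- A `C₀`-semigroup is bounded on bounded time intervals. -/
theorem C0Semigroup.exists_norm_op_le (S : C0Semigroup H) (T : ℝ≥0) :
    ∃ M : ℝ, 0 ≤ M ∧ ∀ s ≤ T, ‖S.op s‖ ≤ M := by
  obtain ⟨M, hM⟩ := banach_steinhaus (g := fun s : Set.Iic T => S.op s) fun x => by
    have hc : IsCompact (Set.Icc (0 : ℝ≥0) T) := isCompact_Icc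
    obtain ⟨C, hC⟩ := hc.exists_bound_of_continuousOn (S.continuous_orbit x).continuousOn
    exact ⟨C, fun s => hC s ⟨zero_le, s.2⟩⟩
  refine ⟨M, (norm_nonneg _).trans (hM ⟨0, show (0 : ℝ≥0) ≤ T from zero_le⟩), fun s hs => hM ⟨s, hs⟩⟩

/-- The conjugated operator `e^{sA} Q e^{sA*}`. -/
noncomputable def conjOp (S : C0Semigroup H) (Q : H →L[ℝ] H) (s : ℝ≥0) : H →L[ℝ] H :=
  S.op s ∘L Q ∘L (S.op s).adjoint

theorem conjOp_add (S : C0Semigroup H) (Q : H →L[ℝ] H) (s t : ℝ≥0) :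
    conjOp S Q (s + t) = S.op s ∘L conjOp S Q t ∘L (S.op s).adjoint := by
  ext x
  simp [conjOp, S.op_add, ContinuousLinearMap.adjoint_comp]

/-- The nuclear representation of `e^{sA} Q e^{sA*}` obtained from one of `Q`. -/
theorem hasSum_conjOp {S : C0Semigroup H} {Q : H →L[ℝ] H} {a b : ℕ → H}
    (hQ : ∀ x, HasSum (fun n => ⟪a n, x⟫ • b n) (Q x)) (s : ℝ≥0) (x : H) :
    HasSum (fun n => ⟪S.op s (a n), x⟫ • S.op s (b n)) (conjOp S Q s x) := by
  have h := (hQ ((S.op s).adjoint x)).mapL (S.op s)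
  simpa [conjOp, ContinuousLinearMap.adjoint_inner_right] using h

/-- When `Q` is of trace class, `s ↦ e^{sA} Q e^{sA*}` is continuous for the operator norm. -/
theorem continuous_conjOp (S : C0Semigroup H) {Q : H →L[ℝ] H} (hQ : IsTraceClass Q) :
    Continuous (conjOp S Q) := by
  obtain ⟨a, b, hab, hQ⟩ := hQ
  rw [continuous_iff_continuousAt]
  intro s₀
  obtain ⟨M, hM0, hM⟩ := S.exists_norm_op_le (s₀ + 1)
  have hs : ∀ s ≤ s₀ + 1, conjOp S Q s
      = ∑' n, InnerProductSpace.rankOne ℝ (S.op s (b n)) (S.op s (a n)) := by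
    intro s hs
    have hsum : Summable fun n => InnerProductSpace.rankOne ℝ (S.op s (b n)) (S.op s (a n)) :=
      Summable.of_norm_bounded (hab.mul_left (M ^ 2)) fun n => norm_rankOne_op_le (hM s hs) _ _
    ext x
    have h1 := hsum.hasSum.mapL (ContinuousLinearMap.apply ℝ H x)
    refine (hasSum_conjOp hQ s x).unique ?_
    simpa using h1
  have hc : ContinuousOn (fun s => ∑' n, InnerProductSpace.rankOne ℝ (S.op s (b n))
      (S.op s (a n))) (Set.Iic (s₀ + 1)) := by
    refine continuousOn_tsum (fun n => ?_) (hab.mul_left (M ^ 2))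
      fun n s hs => norm_rankOne_op_le (hM s hs) _ _
    have h1 : Continuous fun s => InnerProductSpace.rankOne ℝ (S.op s (b n)) :=
      (InnerProductSpace.rankOne ℝ (E := H) (F := H)).continuous.comp (S.continuous_orbit (b n))
    exact (h1.clm_apply (S.continuous_orbit (a n))).continuousOn
  have hn : Set.Iic (s₀ + 1) ∈ 𝓝 s₀ := Iic_mem_nhds (by simp)
  refine (hc.continuousAt hn).congr ?_
  filter_upwards [hn] with s h
  exact (hs s h).symm

theorem covOp_eq_integral (S : C0Semigroup H) (Q : H →L[ℝ] H) (t : ℝ≥0) :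
    covOp S Q t = ∫ s in (0 : ℝ)..t, conjOp S Q s.toNNReal := by
  simp [covOp, weightedCov, conjOp]

theorem covOp_zero (S : C0Semigroup H) (Q : H →L[ℝ] H) : covOp S Q 0 = 0 := by
  simp [covOp_eq_integral]

theorem continuous_conjOp_toNNReal (S : C0Semigroup H) {Q : H →L[ℝ] H} (hQ : IsTraceClass Q) :
    Continuous fun s : ℝ => conjOp S Q s.toNNReal :=
  (continuous_conjOp S hQ).comp continuous_real_toNNReal

theorem apply_covOp {E : Type*} [NormedAddCommGroup E] [NormedSpace ℝ E] [CompleteSpace E]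
    (S : C0Semigroup H) {Q : H →L[ℝ] H} (hQ : IsTraceClass Q)
    (Φ : (H →L[ℝ] H) →L[ℝ] E) (t : ℝ≥0) :
    Φ (covOp S Q t) = ∫ s in (0 : ℝ)..t, Φ (conjOp S Q s.toNNReal) := by
  rw [covOp_eq_integral]
  exact (Φ.intervalIntegral_comp_comm
    ((continuous_conjOp_toNNReal S hQ).intervalIntegrable _ _)).symm

/-- The cocycle identity `Q_{s+t} = Q_s + e^{sA} Q_t e^{sA*}`. -/
theorem covOp_add (S : C0Semigroup H) {Q : H →L[ℝ] H} (hQ : IsTraceClass Q) (s t : ℝ≥0) :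
    covOp S Q (s + t) = covOp S Q s + S.op s ∘L covOp S Q t ∘L (S.op s).adjoint := by
  have hc := continuous_conjOp_toNNReal S hQ
  let Φ : (H →L[ℝ] H) →L[ℝ] (H →L[ℝ] H) := (ContinuousLinearMap.compL ℝ H H H (S.op s)).comp
    ((ContinuousLinearMap.compL ℝ H H H).flip (S.op s).adjoint)
  have hΦ : ∀ T, Φ T = S.op s ∘L T ∘L (S.op s).adjoint := fun T => rfl
  rw [← hΦ, apply_covOp S hQ, covOp_eq_integral, covOp_eq_integral, NNReal.coe_add,
    ← intervalIntegral.integral_add_adjacent_intervals (hc.intervalIntegrable 0 s)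
      (hc.intervalIntegrable s (s + t))]
  congr 1
  have h1 := intervalIntegral.integral_comp_add_left (a := 0) (b := t)
    (fun u : ℝ => conjOp S Q u.toNNReal) s
  rw [add_zero] at h1
  rw [← h1]
  refine intervalIntegral.integral_congr fun u hu => ?_
  rw [Set.uIcc_of_le t.coe_nonneg] at hu
  rw [hΦ, Real.toNNReal_add s.coe_nonneg hu.1, Real.toNNReal_coe, conjOp_add]

/-- The partial traces of `Q_t` are at most `t (sup_{s ≤ t} ‖e^{sA}‖)² ‖Q‖₁`. -/
theorem sum_inner_covOp_le {ι : Type*} (e : HilbertBasis ι ℝ H) (S : C0Semigroup H)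
    {Q : H →L[ℝ] H} {a b : ℕ → H} (hab : Summable fun n => ‖a n‖ * ‖b n‖)
    (hQ : ∀ x, HasSum (fun n => ⟪a n, x⟫ • b n) (Q x)) {t : ℝ≥0} {M : ℝ}
    (hM : ∀ s ≤ t, ‖S.op s‖ ≤ M) (F : Finset ι) :
    ∑ i ∈ F, ⟪covOp S Q t (e i), e i⟫ ≤ t * (M ^ 2 * ∑' n, ‖a n‖ * ‖b n‖) := by
  have hM0 : 0 ≤ M := (norm_nonneg _).trans (hM 0 zero_le)
  have hT : IsTraceClass Q := ⟨a, b, hab, hQ⟩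
  let Φ : (H →L[ℝ] H) →L[ℝ] ℝ :=
    ∑ i ∈ F, (innerSL ℝ (e i)).comp (ContinuousLinearMap.apply ℝ H (e i))
  have hΦ : ∀ T, Φ T = ∑ i ∈ F, ⟪T (e i), e i⟫ := by
    intro T
    simp [Φ, real_inner_comm]
  have hbd : ∀ s ≤ t, Φ (conjOp S Q s) ≤ M ^ 2 * ∑' n, ‖a n‖ * ‖b n‖ := by
    intro s hs
    rw [hΦ]
    have h1 : HasSum (fun n => ∑ i ∈ F, ⟪S.op s (a n), e i⟫ * ⟪S.op s (b n), e i⟫)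
        (∑ i ∈ F, ⟪conjOp S Q s (e i), e i⟫) := by
      refine hasSum_sum fun i _ => ?_
      have h2 := (hasSum_conjOp (S := S) hQ s (e i)).mapL (innerSL ℝ (e i))
      simpa [real_inner_smul_right, real_inner_comm] using h2
    have h3 := hab.hasSum.mul_left (M ^ 2)
    refine hasSum_le (fun n => ?_) h1 h3
    refine (Finset.sum_le_sum fun i _ => le_abs_self _).trans
      ((sum_abs_inner_mul_le e F _ _).trans ?_)
    have := norm_rankOne_op_le (hM s hs) (a n) (b n)
    rwa [InnerProductSpace.norm_rankOne, mul_comm] at this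
  rw [← hΦ, apply_covOp S hT]
  have h := intervalIntegral.integral_mono_on (a := 0) (b := t) (μ := volume) t.2
    ((Φ.continuous.comp (continuous_conjOp_toNNReal S hT)).intervalIntegrable _ _)
    (intervalIntegrable_const (c := M ^ 2 * ∑' n, ‖a n‖ * ‖b n‖)) fun s hs =>
      hbd s.toNNReal (Real.toNNReal_le_iff_le_coe.2 hs.2)
  simpa [mul_left_comm] using h

/-- By the open mapping theorem, the inclusion `im e^{tA} ⊆ im R` yields preimages under `R` whose
norm is controlled. -/
theorem exists_preimage_of_range_subset {L R : H →L[ℝ] H} (h : Set.range L ⊆ Set.range R) :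
    ∃ C : ℝ, 0 ≤ C ∧ ∀ x, ∃ g, R g = L x ∧ ‖g‖ ≤ C * ‖x‖ := by
  -- the graph of the multivalued map `x ↦ R⁻¹ (L x)`
  let D : H × H →L[ℝ] H := L.comp (ContinuousLinearMap.fst ℝ H H)
    - R.comp (ContinuousLinearMap.snd ℝ H H)
  let V : Submodule ℝ (H × H) := LinearMap.ker D.toLinearMap
  have hV : IsClosed (V : Set (H × H)) := D.isClosed_ker
  have : CompleteSpace V := hV.completeSpace_coe
  let π : V →L[ℝ] H := (ContinuousLinearMap.fst ℝ H H).comp V.subtypeL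
  have hmem : ∀ p : H × H, p ∈ V ↔ L p.1 = R p.2 := by
    intro p
    simp [V, D, sub_eq_zero]
  have hπ : Function.Surjective π := by
    intro x
    obtain ⟨g, hg⟩ := h ⟨x, rfl⟩
    exact ⟨⟨(x, g), (hmem _).2 hg.symm⟩, rfl⟩
  obtain ⟨C, hC, hCx⟩ := π.exists_preimage_norm_le hπ
  refine ⟨C, hC.le, fun x => ?_⟩
  obtain ⟨p, hp, hpn⟩ := hCx x
  refine ⟨(p : H × H).2, ?_, (norm_snd_le (p : H × H)).trans hpn⟩
  rw [← (hmem _).1 p.2, ← hp]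
  rfl

end

/-! ### The generator and its eigenvectors -/

section

variable {H : Type*} [NormedAddCommGroup H] [InnerProductSpace ℝ H]

/-- The domain of the generator is invariant under the semigroup. -/
theorem IsGenerator.op_mem_graph {A : H →ₗ.[ℝ] H} {S : C0Semigroup H} (hA : IsGenerator A S)
    {x z : H} (h : (x, z) ∈ A.graph) (t : ℝ≥0) : (S.op t x, S.op t z) ∈ A.graph := by
  rw [hA] at h ⊢
  refine (((S.op t).continuous.tendsto z).comp h).congr fun k => ?_
  rw [Function.comp_apply, map_smul, map_sub, ← S.op_add_apply, ← S.op_add_apply, add_comm]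

/-- Orbits starting in the domain of the generator have a right derivative. -/
theorem IsGenerator.hasDerivWithinAt {A : H →ₗ.[ℝ] H} {S : C0Semigroup H} (hA : IsGenerator A S)
    {x z : H} (h : (x, z) ∈ A.graph) {t : ℝ} (ht : 0 ≤ t) :
    HasDerivWithinAt (fun s : ℝ => S.op s.toNNReal x) (S.op t.toNNReal z) (Set.Ici t) t := by
  have h1 := (hA _ _).1 (hA.op_mem_graph h t.toNNReal)
  rw [hasDerivWithinAt_iff_tendsto_slope, Set.Ici_sdiff_left]
  have h2 : Tendsto (fun s : ℝ => (s - t).toNNReal) (𝓝[>] t) (𝓝[>] 0) := by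
    refine tendsto_nhdsWithin_iff.2 ⟨?_, ?_⟩
    · have : Continuous fun s : ℝ => (s - t).toNNReal := by fun_prop
      have h3 := (this.tendsto t).mono_left (nhdsWithin_le_nhds (s := Set.Ioi t))
      simpa using h3
    · filter_upwards [self_mem_nhdsWithin] with s hs
      simpa using hs
  refine (h1.comp h2).congr' ?_
  filter_upwards [self_mem_nhdsWithin] with s hs
  have hs' : 0 ≤ s - t := sub_nonneg.2 (le_of_lt hs)
  rw [Function.comp_apply, slope_def_module, Real.coe_toNNReal _ hs', ← S.op_add_apply,
    ← Real.toNNReal_add hs' ht, sub_add_cancel]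

/-- A continuous function whose right derivative equals `α` times the function is
`t ↦ e^{αt} f(0)`. -/
theorem eq_exp_smul_of_hasDerivWithinAt {E : Type*} [NormedAddCommGroup E] [NormedSpace ℝ E]
    {f : ℝ → E} {α : ℝ} (hf : Continuous f)
    (hd : ∀ t, 0 ≤ t → HasDerivWithinAt f (α • f t) (Set.Ici t) t) {t : ℝ} (ht : 0 ≤ t) :
    f t = Real.exp (α * t) • f 0 := by
  have hg : ∀ s ∈ Set.Icc 0 t, Real.exp (-α * s) • f s = Real.exp (-α * 0) • f 0 := by
    refine constant_of_has_deriv_right_zero (by fun_prop) fun s hs => ?_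
    have h1 : HasDerivAt (fun s : ℝ => Real.exp (-α * s)) (Real.exp (-α * s) * (-α)) s := by
      simpa using ((hasDerivAt_id s).const_mul (-α)).exp
    have h2 := h1.hasDerivWithinAt.smul (hd s hs.1)
    have h3 : Real.exp (-α * s) • α • f s + (Real.exp (-α * s) * -α) • f s = 0 := by
      rw [smul_smul, ← add_smul]
      ring_nf
      simp
    rwa [h3] at h2
  have h := hg t ⟨ht, le_rfl⟩
  rw [mul_zero, Real.exp_zero, one_smul] at h
  rw [← h, smul_smul, ← Real.exp_add]
  simp

theorem C0Semigroup.continuous_orbit_toNNReal (S : C0Semigroup H) (x : H) :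
    Continuous fun s : ℝ => S.op s.toNNReal x :=
  (S.continuous_orbit x).comp continuous_real_toNNReal

/-- An eigenvector of the generator is an eigenvector of the semigroup. -/
theorem IsGenerator.op_eigenvector {A : H →ₗ.[ℝ] H} {S : C0Semigroup H} (hA : IsGenerator A S)
    {y : H} {α : ℝ} (h : (y, α • y) ∈ A.graph) (t : ℝ≥0) :
    S.op t y = Real.exp (α * t) • y := by
  have h1 := eq_exp_smul_of_hasDerivWithinAt (S.continuous_orbit_toNNReal y) (α := α)
    (fun s hs => by simpa using hA.hasDerivWithinAt h hs) t.coe_nonneg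
  simpa [S.op_zero] using h1

variable [CompleteSpace H]

/-- The generator of a `C₀`-semigroup is densely defined: the averages `h⁻¹ ∫₀ʰ e^{sA} x ds` lie
in its domain and converge to `x`. -/
theorem IsGenerator.dense_domain {A : H →ₗ.[ℝ] H} {S : C0Semigroup H} (hA : IsGenerator A S) :
    Dense (A.domain : Set H) := by
  intro x
  have hc := S.continuous_orbit_toNNReal x
  set F : ℝ → H := fun t => ∫ s in (0 : ℝ)..t, S.op s.toNNReal x with hF
  have hFd : ∀ t, HasDerivAt F (S.op t.toNNReal x) t := fun t =>
    intervalIntegral.integral_hasDerivAt_right (hc.intervalIntegrable _ _)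
      (hc.stronglyMeasurableAtFilter _ _) hc.continuousAt
  have hF0 : F 0 = 0 := by simp [hF]
  have hshift : ∀ (k : ℝ≥0) (t : ℝ), 0 ≤ t → S.op k (F t) = F (t + k) - F k := by
    intro k t ht
    have h1 := intervalIntegral.integral_comp_add_right (a := 0) (b := t)
      (fun u : ℝ => S.op u.toNNReal x) k
    rw [zero_add] at h1
    have h2 : F (t + k) - F k = ∫ s in (k : ℝ)..(t + k), S.op s.toNNReal x := by
      rw [sub_eq_iff_eq_add']
      exact (intervalIntegral.integral_add_adjacent_intervals (hc.intervalIntegrable _ _)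
        (hc.intervalIntegrable _ _)).symm
    rw [h2, ← h1, hF]
    simp only
    rw [← (S.op k).intervalIntegral_comp_comm (hc.intervalIntegrable _ _)]
    refine intervalIntegral.integral_congr fun u hu => ?_
    rw [Set.uIcc_of_le ht] at hu
    rw [← S.op_add_apply, Real.toNNReal_add hu.1 k.coe_nonneg, Real.toNNReal_coe, add_comm]
  have hslope : ∀ t : ℝ, Tendsto (fun k : ℝ≥0 => (k : ℝ)⁻¹ • (F (t + k) - F t)) (𝓝[>] 0)
      (𝓝 (S.op t.toNNReal x)) := by
    intro t
    have h1 := (hFd t).tendsto_slope_zero_right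
    have h2 : Tendsto (fun k : ℝ≥0 => (k : ℝ)) (𝓝[>] 0) (𝓝[>] 0) := by
      refine tendsto_nhdsWithin_iff.2 ⟨?_, ?_⟩
      · exact (NNReal.continuous_coe.tendsto 0).mono_left nhdsWithin_le_nhds
      · filter_upwards [self_mem_nhdsWithin] with k hk
        exact hk
    exact h1.comp h2
  have hmem : ∀ t : ℝ≥0, (F t) ∈ A.domain := by
    intro t
    have h1 : (F t, S.op t x - x) ∈ A.graph := by
      rw [hA]
      have h2 := (hslope t).sub (hslope 0)
      simp only [Real.toNNReal_coe, Real.toNNReal_zero, S.op_zero, zero_add, hF0, sub_zero] at h2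
      refine h2.congr fun k => ?_
      rw [hshift k t t.coe_nonneg, ← smul_sub]
      congr 1
      abel
    exact A.mem_domain_of_mem_graph h1
  have h := hslope 0
  simp only [Real.toNNReal_zero, S.op_zero, zero_add, hF0, sub_zero] at h
  refine mem_closure_of_tendsto h (Eventually.of_forall fun k => ?_)
  exact A.domain.smul_mem _ (hmem k)

/-- An eigenvector of the adjoint of the generator is an eigenvector of the adjoint semigroup. -/
theorem IsGenerator.inner_op_eigenvector {A : H →ₗ.[ℝ] H} {S : C0Semigroup H}
    (hA : IsGenerator A S) {y : H} {α : ℝ} (h : (y, α • y) ∈ A.adjoint.graph) (t : ℝ≥0) (x : H) :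
    ⟪S.op t x, y⟫ = Real.exp (α * t) * ⟪x, y⟫ := by
  have hD := hA.dense_domain
  have hadj : ∀ w : A.domain, ⟪A w, y⟫ = α * ⟪(w : H), y⟫ := by
    intro w
    obtain ⟨y', hy', hAy⟩ := A.adjoint.mem_graph_iff.1 h
    have h1 := A.adjoint_isFormalAdjoint hD y' w
    simp only at hy' hAy
    rw [hAy, hy', real_inner_smul_left] at h1
    rw [real_inner_comm, ← h1, real_inner_comm]
  have hdom : ∀ w ∈ (A.domain : Set H), ⟪S.op t w, y⟫ = Real.exp (α * t) * ⟪w, y⟫ := by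
    intro w hw
    have hg : (w, A ⟨w, hw⟩) ∈ A.graph := A.mem_graph ⟨w, hw⟩
    have h1 := eq_exp_smul_of_hasDerivWithinAt (f := fun s : ℝ => ⟪S.op s.toNNReal w, y⟫) (α := α)
      ((S.continuous_orbit_toNNReal w).inner continuous_const) (fun s hs => ?_) t.coe_nonneg
    · simpa [S.op_zero] using h1
    · have h2 := (hA.hasDerivWithinAt hg hs).inner ℝ (hasDerivWithinAt_const s (Set.Ici s) y)
      obtain ⟨v, hv, hAv⟩ := A.mem_graph_iff.1 (hA.op_mem_graph hg s.toNNReal)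
      simp only at hv hAv
      rw [inner_zero_right, zero_add, ← hAv, hadj, hv] at h2
      exact h2
  have hc1 : Continuous fun x => ⟪S.op t x, y⟫ := by fun_prop
  have hc2 : Continuous fun x => Real.exp (α * t) * ⟪x, y⟫ := by fun_prop
  exact congrFun (hc1.ext_on hD hc2 hdom) x

end

/-! ### Reflection and the transition laws -/

section Reflection

variable {H : Type*} [NormedAddCommGroup H] [InnerProductSpace ℝ H]

theorem reflect_eq {y : H} (hy : ‖y‖ = 1) (x : H) : reflect y x = x - (2 * ⟪x, y⟫) • y := by
  rw [reflect, Submodule.reflection_orthogonal_apply, Submodule.reflection_singleton_apply, hy,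
    real_inner_comm]
  simp [mul_smul, two_smul]

theorem reflect_eq_self {y : H} (hy : ‖y‖ = 1) {x : H} (hx : ⟪x, y⟫ = 0) : reflect y x = x := by
  simp [reflect_eq hy, hx]

theorem reflect_reflect (y x : H) : reflect y (reflect y x) = x :=
  Submodule.reflection_reflection _ x

theorem continuous_reflect (y : H) : Continuous (reflect y) :=
  LinearIsometryEquiv.continuous _

end Reflection

section Gaussian

variable {H : Type*} [NormedAddCommGroup H] [InnerProductSpace ℝ H] [CompleteSpace H]
  [SecondCountableTopology H] [MeasurableSpace H] [BorelSpace H]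

/-- A centered Gaussian measure whose covariance has `y` as an eigenvector is invariant under the
reflection across the hyperplane orthogonal to `y`. -/
theorem IsGaussianWith.map_reflect {B : H →L[ℝ] H} {μ : Measure H} (h : IsGaussianWith 0 B μ)
    {y : H} (hy : ‖y‖ = 1) {c : ℝ} (hB : B y = c • y) : μ.map (reflect y) = μ := by
  let σ : H →L[ℝ] H := ContinuousLinearMap.id ℝ H - (2 : ℝ) • InnerProductSpace.rankOne ℝ y y
  have hσ : ∀ x, σ x = reflect y x := by
    intro x
    simp [σ, reflect_eq hy, real_inner_comm, smul_smul]
  have hσadj : σ.adjoint = σ := by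
    symm
    rw [ContinuousLinearMap.eq_adjoint_iff]
    intro x z
    rw [hσ, hσ, reflect_eq hy, reflect_eq hy, inner_sub_left, inner_sub_right,
      real_inner_smul_left, real_inner_smul_right, real_inner_comm z y]
    ring
  have h1 := h.map σ
  have h2 : σ ∘L B ∘L σ.adjoint = B := by
    ext x
    have h3 : ⟪B x, y⟫ = c * ⟪x, y⟫ := by
      rw [h.isPositive.inner_left_eq_inner_right, hB, real_inner_smul_right]
    rw [hσadj, ContinuousLinearMap.comp_apply, ContinuousLinearMap.comp_apply, hσ, hσ,
      reflect_eq hy, reflect_eq hy, map_sub, map_smul, hB, inner_sub_left, real_inner_smul_left,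
      real_inner_smul_left, h3, real_inner_self_eq_norm_sq, hy, smul_smul, sub_sub, ← add_smul]
    ring_nf
    simp
  rw [map_zero, h2, show (σ : H → H) = reflect y from funext hσ] at h1
  exact h1.unique h

end Gaussian

section Covariance

variable {H : Type*} [NormedAddCommGroup H] [InnerProductSpace ℝ H] [CompleteSpace H]
  {A : H →ₗ.[ℝ] H} {S : C0Semigroup H} {Q : H →L[ℝ] H} {y : H}

/-- The reflection commutes with the semigroup. -/
theorem StandingHypothesis.op_reflect (hyp : StandingHypothesis A S Q y) (hy : ‖y‖ = 1)
    (t : ℝ≥0) (x : H) : S.op t (reflect y x) = reflect y (S.op t x) := by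
  obtain ⟨α, h1, h2⟩ := hyp.eigen_drift
  rw [reflect_eq hy, reflect_eq hy, map_sub, map_smul, hyp.generator.op_eigenvector h1,
    hyp.generator.inner_op_eigenvector h2, smul_smul]
  ring_nf

/-- The direction `y` is an eigenvector of `Q_t`, with a positive eigenvalue when `t > 0`. -/
theorem StandingHypothesis.covOp_eigenvector (hyp : StandingHypothesis A S Q y) (t : ℝ≥0) :
    ∃ c : ℝ, covOp S Q t y = c • y ∧ (0 < t → 0 < c) := by
  obtain ⟨α, h1, h2⟩ := hyp.eigen_drift
  obtain ⟨l, hl, hQ⟩ := hyp.eigen_noise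
  have hadj : ∀ s, (S.op s).adjoint y = Real.exp (α * s) • y := by
    intro s
    refine ext_inner_left ℝ fun x => ?_
    rw [ContinuousLinearMap.adjoint_inner_right, hyp.generator.inner_op_eigenvector h2,
      real_inner_smul_right]
  have hconj : ∀ s, conjOp S Q s y = (l * Real.exp (2 * α * s)) • y := by
    intro s
    rw [conjOp, ContinuousLinearMap.comp_apply, ContinuousLinearMap.comp_apply, hadj, map_smul,
      hQ, map_smul, map_smul, hyp.generator.op_eigenvector h1, smul_smul, smul_smul]
    have : Real.exp (2 * α * s) = Real.exp (α * s) * Real.exp (α * s) := by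
      rw [← Real.exp_add]
      ring_nf
    rw [this]
    ring_nf
  have hc : Continuous fun s : ℝ => l * Real.exp (2 * α * s.toNNReal) := by fun_prop
  refine ⟨∫ s in (0 : ℝ)..t, l * Real.exp (2 * α * s.toNNReal), ?_, fun ht => ?_⟩
  · have h := apply_covOp S hyp.traceClass (ContinuousLinearMap.apply ℝ H y) t
    simp only [ContinuousLinearMap.apply_apply, hconj] at h
    rw [h, intervalIntegral.integral_smul_const]
  · exact intervalIntegral.intervalIntegral_pos_of_pos (hc.intervalIntegrable _ _)
      (fun s => by positivity) (by exact_mod_cast ht)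

variable [SecondCountableTopology H] [MeasurableSpace H] [BorelSpace H]

/-- `𝒩(0, Q_t)` exists, and its first absolute moment is `O(√t)` as `t → 0`. -/
theorem StandingHypothesis.exists_gaussian_covOp (hyp : StandingHypothesis A S Q y) :
    ∃ K : ℝ, ∀ (t : ℝ≥0) (M : ℝ), (∀ s ≤ t, ‖S.op s‖ ≤ M) → ∃ μ : Measure H,
      IsGaussianWith 0 (covOp S Q t) μ ∧ ∫ x, ‖x‖ ∂μ ≤ √(t * (M ^ 2 * K)) := by
  obtain ⟨a, b, hab, hQ⟩ := hyp.traceClass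
  refine ⟨∑' n, ‖a n‖ * ‖b n‖, fun t M hM => ?_⟩
  rcases eq_zero_or_pos t with rfl | ht
  · refine ⟨Measure.dirac 0, ?_, ?_⟩
    · rw [covOp_zero]
      exact isGaussianWith_dirac 0
    · simp
  · obtain ⟨R, hR, hRR, -⟩ := hyp.range_subset t ht
    obtain ⟨w, e, -⟩ := exists_hilbertBasis ℝ H
    have h := exists_isGaussianWith e R (C := t * (M ^ 2 * ∑' n, ‖a n‖ * ‖b n‖)) fun F => by
      refine le_trans (le_of_eq ?_) (sum_inner_covOp_le e S hab hQ hM F)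
      refine Finset.sum_congr rfl fun i _ => ?_
      rw [← hRR, ContinuousLinearMap.comp_apply, hR.inner_left_eq_inner_right,
        real_inner_self_eq_norm_sq]
    rwa [hR.isSelfAdjoint.adjoint_eq, hRR] at h

theorem StandingHypothesis.isGaussianWith_covOp (hyp : StandingHypothesis A S Q y) (t : ℝ≥0) :
    IsGaussianWith 0 (covOp S Q t) (gaussianMeasure 0 (covOp S Q t)) := by
  obtain ⟨K, hK⟩ := hyp.exists_gaussian_covOp
  obtain ⟨M, -, hM⟩ := S.exists_norm_op_le t
  obtain ⟨μ, hμ, -⟩ := hK t M hM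
  rwa [hμ.gaussianMeasure_eq]

theorem StandingHypothesis.integral_norm_le (hyp : StandingHypothesis A S Q y) :
    ∃ K : ℝ, ∀ (t : ℝ≥0) (M : ℝ), (∀ s ≤ t, ‖S.op s‖ ≤ M) →
      ∫ x, ‖x‖ ∂(gaussianMeasure 0 (covOp S Q t)) ≤ √(t * (M ^ 2 * K)) := by
  obtain ⟨K, hK⟩ := hyp.exists_gaussian_covOp
  refine ⟨K, fun t M hM => ?_⟩
  obtain ⟨μ, hμ, h⟩ := hK t M hM
  rwa [hμ.gaussianMeasure_eq]

theorem StandingHypothesis.isGaussianWith_translate (hyp : StandingHypothesis A S Q y) (t : ℝ≥0)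
    (m : H) : IsGaussianWith m (covOp S Q t) (gaussianMeasure m (covOp S Q t)) := by
  have h := (hyp.isGaussianWith_covOp t).map_const_add m
  rw [add_zero] at h
  rwa [h.gaussianMeasure_eq]

theorem StandingHypothesis.ouT_eq (hyp : StandingHypothesis A S Q y) (t : ℝ≥0) (f : H → ℝ)
    (x : H) : ouT S Q t f x = ∫ z, f (S.op t x + z) ∂(gaussianMeasure 0 (covOp S Q t)) := by
  have h := (hyp.isGaussianWith_covOp t).map_const_add (S.op t x)
  rw [add_zero] at h
  rw [ouT, h.gaussianMeasure_eq, (measurableEmbedding_addLeft (S.op t x)).integral_map]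

/-- The transition law splits according to the cocycle identity for `Q_t`. -/
theorem StandingHypothesis.gaussianMeasure_add (hyp : StandingHypothesis A S Q y) (s t : ℝ≥0) :
    gaussianMeasure 0 (covOp S Q (s + t)) = (gaussianMeasure 0 (covOp S Q s)).conv
      ((gaussianMeasure 0 (covOp S Q t)).map (S.op s)) := by
  have h := (hyp.isGaussianWith_covOp s).conv ((hyp.isGaussianWith_covOp t).map (S.op s))
  rw [map_zero, add_zero, ← covOp_add S hyp.traceClass] at h
  exact h.gaussianMeasure_eq

end Covariance

/-! ### The Ornstein–Uhlenbeck semigroup on the whole space -/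

section

variable {H : Type*} [NormedAddCommGroup H] [InnerProductSpace ℝ H] [CompleteSpace H]
  [SecondCountableTopology H] [MeasurableSpace H] [BorelSpace H]
  {A : H →ₗ.[ℝ] H} {S : C0Semigroup H} {Q : H →L[ℝ] H} {y : H}

theorem StandingHypothesis.isProbabilityMeasure_gaussianMeasure
    (hyp : StandingHypothesis A S Q y) (t : ℝ≥0) (m : H) :
    IsProbabilityMeasure (gaussianMeasure m (covOp S Q t)) :=
  (hyp.isGaussianWith_translate t m).isProbabilityMeasure

theorem integrable_of_abs_le {X : Type*} [MeasurableSpace X] (μ : Measure X) [IsFiniteMeasure μ]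
    {f : X → ℝ} (hf : Measurable f) {M : ℝ} (hM : ∀ x, |f x| ≤ M) : Integrable f μ :=
  Integrable.of_bound hf.aestronglyMeasurable M (ae_of_all _ hM)

theorem StandingHypothesis.abs_ouT_le (hyp : StandingHypothesis A S Q y) (t : ℝ≥0) {f : H → ℝ}
    {M : ℝ} (hM : ∀ x, |f x| ≤ M) (x : H) : |ouT S Q t f x| ≤ M := by
  have := hyp.isProbabilityMeasure_gaussianMeasure t (S.op t x)
  have h := norm_integral_le_of_norm_le_const (μ := gaussianMeasure (S.op t x) (covOp S Q t))
    (f := f) (ae_of_all _ hM)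
  simpa [ouT] using h

theorem ouT_zero (S : C0Semigroup H) (Q : H →L[ℝ] H) {f : H → ℝ}
    (hf : Measurable f) (x : H) : ouT S Q 0 f x = f x := by
  have h : gaussianMeasure (S.op 0 x) (covOp S Q 0) = Measure.dirac x := by
    rw [covOp_zero, S.op_zero]
    exact (isGaussianWith_dirac x).gaussianMeasure_eq
  rw [ouT, h, integral_dirac' _ _ hf.stronglyMeasurable]

theorem StandingHypothesis.ouT_add_fun (hyp : StandingHypothesis A S Q y) (t : ℝ≥0)
    {f g : H → ℝ} (hf : Measurable f) (hg : Measurable g) {M N : ℝ} (hM : ∀ x, |f x| ≤ M)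
    (hN : ∀ x, |g x| ≤ N) (x : H) : ouT S Q t (f + g) x = ouT S Q t f x + ouT S Q t g x := by
  have := hyp.isProbabilityMeasure_gaussianMeasure t (S.op t x)
  exact integral_add (integrable_of_abs_le _ hf hM) (integrable_of_abs_le _ hg hN)

theorem StandingHypothesis.measurable_ouT (hyp : StandingHypothesis A S Q y) (t : ℝ≥0)
    {f : H → ℝ} (hf : Measurable f) : Measurable (ouT S Q t f) := by
  have := hyp.isProbabilityMeasure_gaussianMeasure t 0
  rw [show ouT S Q t f = fun x => ∫ z, f (S.op t x + z) ∂(gaussianMeasure 0 (covOp S Q t)) from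
    funext (hyp.ouT_eq t f)]
  have h : Measurable fun p : H × H => f (S.op t p.1 + p.2) := by fun_prop
  exact h.stronglyMeasurable.integral_prod_right'.measurable

/-- The Chapman–Kolmogorov equation `T_{s+t} = T_s T_t`. -/
theorem StandingHypothesis.ouT_add (hyp : StandingHypothesis A S Q y) (s t : ℝ≥0)
    {f : H → ℝ} (hf : Measurable f) {M : ℝ} (hM : ∀ x, |f x| ≤ M) (x : H) :
    ouT S Q (s + t) f x = ouT S Q s (ouT S Q t f) x := by
  have := hyp.isProbabilityMeasure_gaussianMeasure t 0
  have := hyp.isProbabilityMeasure_gaussianMeasure s 0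
  have : IsProbabilityMeasure ((gaussianMeasure 0 (covOp S Q s)).map (S.op t)) :=
    Measure.isProbabilityMeasure_map (by fun_prop)
  have hm : Measurable fun z => f (S.op (t + s) x + z) := by fun_prop
  have hm2 : Measurable fun p : H × H => f (S.op (t + s) x + (p.2 + p.1)) := by fun_prop
  rw [add_comm s t, hyp.ouT_eq (t + s), hyp.gaussianMeasure_add t s, Measure.conv_comm,
    integral_conv (integrable_of_abs_le _ hm fun _ => hM _), hyp.ouT_eq s,
    integral_map (by fun_prop) (by
      have : Measurable fun p : H × H => f (S.op (t + s) x + (p.1 + p.2)) := by fun_prop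
      exact this.stronglyMeasurable.integral_prod_right'.aestronglyMeasurable)]
  congr 1
  ext z
  rw [hyp.ouT_eq t, map_add, ← S.op_add_apply]
  simp_rw [add_assoc]

/-- `T_t` commutes with the reflection. -/
theorem StandingHypothesis.ouT_comp_reflect (hyp : StandingHypothesis A S Q y) (hy : ‖y‖ = 1)
    (t : ℝ≥0) {f : H → ℝ} (hf : Measurable f) (x : H) :
    ouT S Q t (fun z => f (reflect y z)) x = ouT S Q t f (reflect y x) := by
  obtain ⟨c, hc, -⟩ := hyp.covOp_eigenvector t
  have h := (hyp.isGaussianWith_covOp t).map_reflect hy hc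
  have hm : Measurable fun z => f (S.op t (reflect y x) + z) := by fun_prop
  rw [hyp.ouT_eq, hyp.ouT_eq]
  conv_rhs => rw [← h, integral_map (continuous_reflect y).measurable.aemeasurable
    hm.aestronglyMeasurable]
  simp_rw [hyp.op_reflect hy]
  congr 1
  ext z
  congr 1
  exact map_add (ℝ ∙ y)ᗮ.reflection _ _

/-- For `t > 0`, the transition laws do not charge the boundary hyperplane, so `T_t f` does not
depend on the values of `f` there. -/
theorem StandingHypothesis.ouT_congr (hyp : StandingHypothesis A S Q y) (hy : ‖y‖ = 1)
    {t : ℝ≥0} (ht : 0 < t) {f g : H → ℝ} (hfg : ∀ x, ⟪x, y⟫ ≠ 0 → f x = g x) (x : H) :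
    ouT S Q t f x = ouT S Q t g x := by
  obtain ⟨c, hc, hc0⟩ := hyp.covOp_eigenvector t
  have h := (hyp.isGaussianWith_translate t (S.op t x)).measure_inner_eq_zero (u := y) (by
    rw [hc, real_inner_smul_left, real_inner_self_eq_norm_sq, hy]
    simpa using (hc0 ht).ne')
  refine integral_congr_ae ?_
  have h2 : ∀ᵐ z ∂(gaussianMeasure (S.op t x) (covOp S Q t)), ⟪z, y⟫ ≠ 0 := by
    rw [ae_iff]
    simpa using h
  filter_upwards [h2] with z hz using hfg z hz

/-- If `f` is odd with respect to the reflection off the boundary hyperplane, then `T_t f`, with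
`t > 0`, is odd everywhere. -/
theorem StandingHypothesis.ouT_reflect_of_odd (hyp : StandingHypothesis A S Q y) (hy : ‖y‖ = 1)
    {t : ℝ≥0} (ht : 0 < t) {f : H → ℝ} (hf : Measurable f)
    (hodd : ∀ x, ⟪x, y⟫ ≠ 0 → f (reflect y x) = -f x) (x : H) :
    ouT S Q t f (reflect y x) = -ouT S Q t f x := by
  rw [← hyp.ouT_comp_reflect hy t hf, hyp.ouT_congr hy ht (g := fun z => -f z) hodd]
  exact integral_neg _

/-- The strong Feller property, in the uniform sense: `T_t`, with `t > 0`, maps bounded measurable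
functions to uniformly continuous ones. -/
theorem StandingHypothesis.uniformContinuous_ouT (hyp : StandingHypothesis A S Q y) {t : ℝ≥0}
    (ht : 0 < t) {f : H → ℝ} (hf : Measurable f) {M : ℝ} (hM : ∀ x, |f x| ≤ M) :
    UniformContinuous (ouT S Q t f) := by
  obtain ⟨R, hR, hRR, hrange⟩ := hyp.range_subset t ht
  obtain ⟨C, hC0, hC⟩ := exists_preimage_of_range_subset hrange
  obtain ⟨w, e, -⟩ := exists_hilbertBasis ℝ H
  obtain ⟨a, b, hab, hQ⟩ := hyp.traceClass
  obtain ⟨N, -, hN⟩ := S.exists_norm_op_le t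
  have hHS : ∀ F : Finset w, ∑ i ∈ F, ‖R (e i)‖ ^ 2 ≤ t * (N ^ 2 * ∑' n, ‖a n‖ * ‖b n‖) := by
    intro F
    refine le_trans (le_of_eq ?_) (sum_inner_covOp_le e S hab hQ hN F)
    refine Finset.sum_congr rfl fun i _ => ?_
    rw [← hRR, ContinuousLinearMap.comp_apply, hR.inner_left_eq_inner_right,
      real_inner_self_eq_norm_sq]
  have hμ := hyp.isGaussianWith_covOp t
  nth_rewrite 1 [← hRR] at hμ
  have hM0 : 0 ≤ M := (abs_nonneg _).trans (hM 0)
  have hle : ∀ x z, |ouT S Q t f x - ouT S Q t f z|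
      ≤ M * √(Real.exp ((C * ‖x - z‖) ^ 2) - 1) := by
    intro x z
    obtain ⟨g, hg, hgn⟩ := hC (x - z)
    have h := abs_integral_shift_sub_le e hR hHS hμ (φ := fun u => f (S.op t z + u))
      (by fun_prop) (fun _ => hM _) g
    have h2 : ∀ u, S.op t z + (R g + u) = S.op t x + u := by
      intro u
      rw [hg, map_sub]
      abel
    simp_rw [h2] at h
    rw [hyp.ouT_eq, hyp.ouT_eq]
    refine h.trans ?_
    gcongr
  have hlim : Tendsto (fun r : ℝ => M * √(Real.exp ((C * r) ^ 2) - 1)) (𝓝 0) (𝓝 0) := by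
    have : Continuous fun r : ℝ => M * √(Real.exp ((C * r) ^ 2) - 1) := by fun_prop
    simpa using this.tendsto 0
  rw [Metric.uniformContinuous_iff]
  intro ε hε
  obtain ⟨δ, hδ, h⟩ := Metric.tendsto_nhds_nhds.1 hlim ε hε
  refine ⟨δ, hδ, fun {x z} hxz => ?_⟩
  rw [Real.dist_eq]
  refine (hle x z).trans_lt ?_
  have h2 := h (x := ‖x - z‖) (by simpa [dist_eq_norm] using hxz)
  rw [Real.dist_eq, sub_zero] at h2
  exact (le_abs_self _).trans_lt h2

/-- The transition laws at two times are coupled by an increment whose first moment is controlled,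
so the integrals of a Lipschitz function are close. -/
theorem StandingHypothesis.abs_ouT_sub_le_of_lipschitz (hyp : StandingHypothesis A S Q y)
    (T : ℝ≥0) : ∃ K M : ℝ, ∀ (f : H → ℝ) (L : ℝ≥0) (_ : LipschitzWith L f) (C : ℝ)
      (_ : ∀ x, |f x| ≤ C) (s r : ℝ≥0) (_ : s + r ≤ T) (x : H),
      |ouT S Q (s + r) f x - ouT S Q s f x|
        ≤ L * (‖S.op (s + r) x - S.op s x‖ + M * √(r * K)) := by
  obtain ⟨K, hK⟩ := hyp.integral_norm_le
  obtain ⟨M, hM0, hM⟩ := S.exists_norm_op_le T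
  refine ⟨M ^ 2 * K, M, fun f L hL C hC s r hsr x => ?_⟩
  have hs : s ≤ T := le_self_add.trans hsr
  have hr : r ≤ T := le_add_self.trans hsr
  have hfm : Measurable f := hL.continuous.measurable
  have hPs := hyp.isProbabilityMeasure_gaussianMeasure s 0
  have hPr := hyp.isProbabilityMeasure_gaussianMeasure r 0
  have : IsGaussian (gaussianMeasure 0 (covOp S Q r)) := (hyp.isGaussianWith_covOp r).1
  set μ := gaussianMeasure 0 (covOp S Q s)
  set ν := gaussianMeasure 0 (covOp S Q r) with hν
  have hPν : IsProbabilityMeasure (ν.map (S.op s)) :=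
    Measure.isProbabilityMeasure_map (by fun_prop)
  have hint : Integrable (fun w => ‖w‖) ν := IsGaussian.integrable_id.norm
  have hmom : ∫ w, ‖w‖ ∂ν ≤ √(r * (M ^ 2 * K)) := hK r M fun u hu => hM u (hu.trans hr)
  set d := ‖S.op (s + r) x - S.op s x‖
  have hm : Measurable fun z => f (S.op (s + r) x + z) := by fun_prop
  have hm2 : Measurable fun p : H × H => f (S.op (s + r) x + (p.1 + p.2)) := by fun_prop
  have hin : ∀ z, ‖∫ w, f (S.op (s + r) x + (z + w)) ∂(ν.map (S.op s)) - f (S.op s x + z)‖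
      ≤ L * (d + M * √(r * (M ^ 2 * K))) := by
    intro z
    have hmz : Measurable fun w => f (S.op (s + r) x + (z + w)) := by fun_prop
    have hmz2 : Measurable fun w => f (S.op (s + r) x + (z + S.op s w)) := by fun_prop
    rw [integral_map (by fun_prop) hmz.aestronglyMeasurable]
    have h1 : ∫ w, f (S.op (s + r) x + (z + S.op s w)) ∂ν - f (S.op s x + z)
        = ∫ w, (f (S.op (s + r) x + (z + S.op s w)) - f (S.op s x + z)) ∂ν := by
      rw [integral_sub (integrable_of_abs_le _ hmz2 fun _ => hC _) (integrable_const _)]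
      simp
    rw [h1, Real.norm_eq_abs]
    calc |∫ w, (f (S.op (s + r) x + (z + S.op s w)) - f (S.op s x + z)) ∂ν|
        ≤ ∫ w, |f (S.op (s + r) x + (z + S.op s w)) - f (S.op s x + z)| ∂ν :=
          abs_integral_le_integral_abs
      _ ≤ ∫ w, (L * d + L * M * ‖w‖) ∂ν := by
          refine integral_mono ((integrable_of_abs_le _ hmz2 fun _ => hC _).sub
            (integrable_const _)).abs ((integrable_const _).add (hint.const_mul _)) fun w => ?_
          have h2 := hL.dist_le_mul (S.op (s + r) x + (z + S.op s w)) (S.op s x + z)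
          rw [Real.dist_eq, dist_eq_norm] at h2
          refine h2.trans ?_
          rw [mul_assoc, ← mul_add]
          refine mul_le_mul_of_nonneg_left ?_ L.coe_nonneg
          have h3 : S.op (s + r) x + (z + S.op s w) - (S.op s x + z)
              = (S.op (s + r) x - S.op s x) + S.op s w := by abel
          rw [h3]
          exact (norm_add_le _ _).trans
            (add_le_add le_rfl ((S.op s).le_of_opNorm_le (hM s hs) w))
      _ = L * (d + M * ∫ w, ‖w‖ ∂ν) := by
          rw [integral_add (integrable_const _) (hint.const_mul _), integral_const_mul (L * M : ℝ) fun w => ‖w‖]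
          simp
          ring
      _ ≤ _ := by gcongr
  rw [hyp.ouT_eq, hyp.ouT_eq, hyp.gaussianMeasure_add,
    integral_conv (integrable_of_abs_le _ hm fun _ => hC _)]
  have hi1 : Integrable (fun z => ∫ w, f (S.op (s + r) x + (z + w)) ∂(ν.map (S.op s))) μ :=
    (integrable_of_abs_le (μ.prod (ν.map (S.op s))) hm2 fun _ => hC _).integral_prod_left
  have hi2 : Integrable (fun z => f (S.op s x + z)) μ :=
    integrable_of_abs_le _ (by fun_prop) fun _ => hC _
  rw [← integral_sub hi1 hi2]
  have := norm_integral_le_of_norm_le_const (μ := μ) (ae_of_all _ hin)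
  simpa using this

/-- The transition law at time `t` from `x`, as a probability measure. -/
noncomputable def StandingHypothesis.law (hyp : StandingHypothesis A S Q y) (x : H) (t : ℝ≥0) :
    ProbabilityMeasure H :=
  ⟨gaussianMeasure (S.op t x) (covOp S Q t),
    hyp.isProbabilityMeasure_gaussianMeasure t (S.op t x)⟩

/-- The transition laws depend weakly continuously on time. -/
theorem StandingHypothesis.continuous_law (hyp : StandingHypothesis A S Q y) (x : H) :
    Continuous (hyp.law x) := by
  rw [continuous_iff_continuousAt]
  intro t
  rw [ContinuousAt, tendsto_iff_forall_lipschitz_integral_tendsto]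
  rintro f ⟨D, hD⟩ ⟨L, hL⟩
  have hC : ∀ z, |f z| ≤ |f 0| + D := by
    intro z
    have h := hD z 0
    rw [Real.dist_eq] at h
    have := abs_sub_abs_le_abs_sub (f z) (f 0)
    linarith
  obtain ⟨K, M, hKM⟩ := hyp.abs_ouT_sub_le_of_lipschitz (t + 1)
  change Tendsto (fun t' => ouT S Q t' f x) (𝓝 t) (𝓝 (ouT S Q t f x))
  have hle : ∀ t' ≤ t + 1, |ouT S Q t' f x - ouT S Q t f x|
      ≤ L * (‖S.op t' x - S.op t x‖ + M * √(|(t' : ℝ) - t| * K)) := by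
    intro t' ht'
    rcases le_total t t' with h | h
    · obtain ⟨r, rfl⟩ := exists_add_of_le h
      have h1 := hKM f L hL _ hC t r ht' x
      simpa using h1
    · obtain ⟨r, rfl⟩ := exists_add_of_le h
      have h1 := hKM f L hL _ hC t' r le_self_add x
      rw [abs_sub_comm, norm_sub_rev]
      simpa using h1
  have hlim : Tendsto (fun t' : ℝ≥0 => L * (‖S.op t' x - S.op t x‖
      + M * √(|(t' : ℝ) - t| * K))) (𝓝 t) (𝓝 0) := by
    have h1 := S.continuous_orbit x
    have h2 : Continuous (fun t' : ℝ≥0 => L * (‖S.op t' x - S.op t x‖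
      + M * √(|(t' : ℝ) - t| * K))) := by fun_prop
    simpa using h2.tendsto t
  rw [tendsto_iff_dist_tendsto_zero]
  refine squeeze_zero' (Eventually.of_forall fun _ => dist_nonneg) ?_ hlim
  filter_upwards [Iic_mem_nhds (show t < t + 1 by simp)] with t' ht'
  rw [Real.dist_eq]
  exact hle t' ht'

theorem StandingHypothesis.continuous_ouT_time (hyp : StandingHypothesis A S Q y) {f : H → ℝ}
    (hf : Continuous f) {M : ℝ} (hM : ∀ x, |f x| ≤ M) (x : H) :
    Continuous fun t : ℝ≥0 => ouT S Q t f x := by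
  let F : BoundedContinuousFunction H ℝ := BoundedContinuousFunction.ofNormedAddCommGroup f hf M hM
  rw [continuous_iff_continuousAt]
  intro t
  exact ProbabilityMeasure.tendsto_iff_forall_integral_tendsto.1
    ((hyp.continuous_law x).tendsto t) F

end

/-! ### Odd extension and the semigroup on the half-space -/

section OddExtension

variable {H : Type*} [NormedAddCommGroup H] [InnerProductSpace ℝ H]

open Classical in
/-- The folding map of `H` onto the closed half-space, `(x₁, x') ↦ (|x₁|, x')`. -/
noncomputable def fold (y x : H) : closedHalf y :=
  if h : 0 ≤ ⟪x, y⟫ then ⟨x, h⟩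
  else ⟨reflect y x, by
    change 0 ≤ ⟪reflect y x, y⟫
    rw [inner_reflect]
    linarith⟩

theorem coe_fold {y : H} (hy : ‖y‖ = 1) (x : H) :
    (fold y x : H) = x - (⟪x, y⟫ - |⟪x, y⟫|) • y := by
  unfold fold
  split_ifs with h
  · simp [abs_of_nonneg h]
  · simp only
    rw [reflect_eq hy, abs_of_neg (not_le.1 h)]
    ring_nf

theorem continuous_fold {y : H} (hy : ‖y‖ = 1) : Continuous (fold y) := by
  refine continuous_induced_rng.2 ?_
  change Continuous fun x => (fold y x : H)
  simp_rw [coe_fold hy]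
  fun_prop

theorem extClosed_eq (y : H) (η : closedHalf y → ℝ) (x : H) :
    extClosed y η x = if 0 ≤ ⟪x, y⟫ then η (fold y x) else -η (fold y x) := by
  unfold extClosed fold
  split_ifs <;> rfl

theorem extClosed_coe (y : H) (η : closedHalf y → ℝ) (x : closedHalf y) :
    extClosed y η x = η x := by
  have h : 0 ≤ ⟪(x : H), y⟫ := x.2
  rw [extClosed, dif_pos h]

theorem abs_extClosed_le {y : H} {η : closedHalf y → ℝ} {M : ℝ} (hM : ∀ x, |η x| ≤ M) (x : H) :
    |extClosed y η x| ≤ M := by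
  rw [extClosed_eq]
  split_ifs
  · exact hM _
  · rw [abs_neg]
    exact hM _

theorem extClosed_reflect {y : H} (η : closedHalf y → ℝ) {x : H} (hx : ⟪x, y⟫ ≠ 0) :
    extClosed y η (reflect y x) = -extClosed y η x := by
  rcases lt_or_gt_of_ne hx with h | h
  · have h1 : 0 ≤ ⟪reflect y x, y⟫ := by
      rw [inner_reflect]
      linarith
    rw [extClosed, dif_pos h1, extClosed, dif_neg (not_le.2 h), neg_neg]
  · have h1 : ¬ 0 ≤ ⟪reflect y x, y⟫ := by
      rw [inner_reflect]
      linarith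
    rw [extClosed, dif_neg h1, extClosed, dif_pos h.le]
    simp only [reflect_reflect]

theorem extClosed_add (y : H) (η θ : closedHalf y → ℝ) :
    extClosed y (η + θ) = extClosed y η + extClosed y θ := by
  ext x
  simp only [extClosed_eq, Pi.add_apply]
  split_ifs <;> ring

theorem extClosed_smul (y : H) (c : ℝ) (η : closedHalf y → ℝ) :
    extClosed y (c • η) = c • extClosed y η := by
  ext x
  simp only [extClosed_eq, Pi.smul_apply, smul_eq_mul]
  split_ifs <;> ring

theorem continuous_extClosed {y : H} (hy : ‖y‖ = 1) {η : closedHalf y → ℝ} (hη : η ∈ C0 y) :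
    Continuous (extClosed y η) := by
  rw [show extClosed y η = fun x => if 0 ≤ ⟪x, y⟫ then η (fold y x) else -η (fold y x) from
    funext (extClosed_eq y η)]
  have h := hη.1.comp (continuous_fold hy)
  refine Continuous.if_le h h.neg continuous_const (by fun_prop) fun x hx => ?_
  have h1 : η (fold y x) = 0 := by
    refine hη.2.2 _ ?_
    rw [coe_fold hy, ← hx]
    simp [← hx]
  simp [h1]

theorem measurable_extClosed [MeasurableSpace H] [BorelSpace H] {y : H} (hy : ‖y‖ = 1)
    {η : closedHalf y → ℝ} (hη : Measurable η) : Measurable (extClosed y η) := by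
  rw [show extClosed y η = fun x => if 0 ≤ ⟪x, y⟫ then η (fold y x) else -η (fold y x) from
    funext (extClosed_eq y η)]
  have h := hη.comp (continuous_fold hy).measurable
  have hc : Continuous fun x => ⟪x, y⟫ := by fun_prop
  exact Measurable.ite (measurableSet_le measurable_const hc.measurable) h h.neg

open Classical in
/-- The extension of a function on the open half-space by `0` to the closed half-space. -/
noncomputable def zeroExt (y : H) (η : openHalf y → ℝ) (x : closedHalf y) : ℝ :=
  if h : 0 < ⟪(x : H), y⟫ then η ⟨x, h⟩ else 0

theorem extOpen_eq (y : H) (η : openHalf y → ℝ) : extOpen y η = extClosed y (zeroExt y η) := by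
  ext x
  rcases lt_trichotomy ⟪x, y⟫ 0 with h | h | h
  · have h1 : 0 < ⟪reflect y x, y⟫ := by
      rw [inner_reflect]
      linarith
    rw [extOpen, dif_neg h.not_gt, dif_pos h, extClosed, dif_neg (not_le.2 h), zeroExt,
      dif_pos h1]
  · rw [extOpen, dif_neg h.not_gt, dif_neg h.not_lt, extClosed, dif_pos h.ge, zeroExt,
      dif_neg h.not_gt]
  · rw [extOpen, dif_pos h, extClosed, dif_pos h.le, zeroExt, dif_pos h]

theorem zeroExt_mem_Bb [MeasurableSpace H] [BorelSpace H] {y : H} {η : openHalf y → ℝ}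
    (hη : η ∈ Bb (openHalf y)) : zeroExt y η ∈ Bb (closedHalf y) := by
  obtain ⟨hm, C, hC⟩ := hη
  have hc : Continuous fun x : closedHalf y => ⟪(x : H), y⟫ := by fun_prop
  refine ⟨?_, |C|, fun x => ?_⟩
  · have hs : MeasurableSet {x : closedHalf y | 0 < ⟪(x : H), y⟫} :=
      measurableSet_lt measurable_const hc.measurable
    refine Measurable.dite (s := {x : closedHalf y | 0 < ⟪(x : H), y⟫})
      (f := fun x => η ⟨((x : closedHalf y) : H), x.2⟩) (g := fun _ => 0) ?_ measurable_const hs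
    exact hm.comp ((measurable_subtype_coe.comp measurable_subtype_coe).subtype_mk)
  · unfold zeroExt
    split_ifs
    · exact (hC _).trans (le_abs_self C)
    · simp

theorem abs_le_supNorm {X : Type*} {f : X → ℝ} (hf : ∃ C : ℝ, ∀ x, |f x| ≤ C) (x : X) :
    |f x| ≤ supNorm f := by
  obtain ⟨C, hC⟩ := hf
  exact le_ciSup (f := fun x => |f x|) ⟨C, by rintro _ ⟨x, rfl⟩; exact hC x⟩ x

end OddExtension

section HalfSpaceSemigroup

variable {H : Type*} [NormedAddCommGroup H] [InnerProductSpace ℝ H] [CompleteSpace H]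
  [MeasurableSpace H] [BorelSpace H] {A : H →ₗ.[ℝ] H} {S : C0Semigroup H} {Q : H →L[ℝ] H} {y : H}

theorem P_apply (t : ℝ≥0) (η : closedHalf y → ℝ) (x : closedHalf y) :
    P S Q y t η x = ouT S Q t (extClosed y η) x := rfl

variable [SecondCountableTopology H]

theorem P_zero (S : C0Semigroup H) (Q : H →L[ℝ] H) (hy : ‖y‖ = 1)
    {f : closedHalf y → ℝ} (hf : f ∈ Bb (closedHalf y)) : P S Q y 0 f = f := by
  ext x
  rw [P_apply, ouT_zero S Q (measurable_extClosed hy hf.1), extClosed_coe]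

/-- For `t > 0`, the odd extension of `P_t f` is `T_t` applied to the odd extension of `f`. -/
theorem StandingHypothesis.extClosed_P (hyp : StandingHypothesis A S Q y) (hy : ‖y‖ = 1)
    {t : ℝ≥0} (ht : 0 < t) {f : closedHalf y → ℝ} (hf : f ∈ Bb (closedHalf y)) :
    extClosed y (P S Q y t f) = ouT S Q t (extClosed y f) := by
  ext x
  have hodd := hyp.ouT_reflect_of_odd hy ht (measurable_extClosed hy hf.1)
    (fun x hx => extClosed_reflect f hx)
  unfold extClosed
  split_ifs with h
  · rfl
  · change -(ouT S Q t (extClosed y f) (reflect y x)) = _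
    rw [hodd, neg_neg]
    rfl

theorem StandingHypothesis.P_mem_UC0 (hyp : StandingHypothesis A S Q y) (hy : ‖y‖ = 1)
    {t : ℝ≥0} (ht : 0 < t) {f : closedHalf y → ℝ} (hf : f ∈ Bb (closedHalf y)) :
    P S Q y t f ∈ UC0 y := by
  obtain ⟨hm, C, hC⟩ := hf
  have hm' := measurable_extClosed hy hm
  have hC' := abs_extClosed_le hC
  refine ⟨?_, ⟨C, fun x => hyp.abs_ouT_le t hC' x⟩, fun x hx => ?_⟩
  · exact (hyp.uniformContinuous_ouT ht hm' hC').comp uniformContinuous_subtype_val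
  · have h := hyp.ouT_reflect_of_odd hy ht hm' (fun x hx => extClosed_reflect f hx) (x : H)
    rw [reflect_eq_self hy hx] at h
    rw [P_apply]
    linarith

theorem StandingHypothesis.isContractionSemigroup (hyp : StandingHypothesis A S Q y)
    (hy : ‖y‖ = 1) : IsContractionSemigroup (P S Q y) where
  mem t f hf := by
    obtain ⟨hm, C, hC⟩ := hf
    exact ⟨(hyp.measurable_ouT t (measurable_extClosed hy hm)).comp measurable_subtype_coe, C,
      fun x => hyp.abs_ouT_le t (abs_extClosed_le hC) x⟩
  map_add t f hf g hg := by
    obtain ⟨hm, C, hC⟩ := hf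
    obtain ⟨hm', C', hC'⟩ := hg
    ext x
    rw [P_apply, extClosed_add, hyp.ouT_add_fun t (measurable_extClosed hy hm)
      (measurable_extClosed hy hm') (abs_extClosed_le hC) (abs_extClosed_le hC')]
    rfl
  map_smul t c f _ := by
    ext x
    rw [P_apply, extClosed_smul]
    exact integral_const_mul c _
  contraction t f hf := by
    have : Nonempty (closedHalf y) := ⟨⟨0, by simp [closedHalf]⟩⟩
    exact ciSup_le fun x => hyp.abs_ouT_le t (abs_extClosed_le (abs_le_supNorm hf.2)) x
  zero f hf := P_zero S Q hy hf
  add s t f hf := by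
    rcases eq_zero_or_pos t with rfl | ht
    · rw [P_zero S Q hy hf, add_zero]
    · obtain ⟨hm, C, hC⟩ := hf
      ext x
      rw [P_apply, P_apply, hyp.extClosed_P hy ht ⟨hm, C, hC⟩,
        hyp.ouT_add s t (measurable_extClosed hy hm) (abs_extClosed_le hC)]

end HalfSpaceSemigroup

end HalfSpaceOU

theorem proposition2p7 {H : Type*} [NormedAddCommGroup H] [InnerProductSpace ℝ H] [CompleteSpace H]
    [TopologicalSpace.SeparableSpace H] [MeasurableSpace H] [BorelSpace H]
    (A : H →ₗ.[ℝ] H) (S : HalfSpaceOU.C0Semigroup H) (Q : H →L[ℝ] H) (y : H) (hy : ‖y‖ = 1)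
    (hyp : HalfSpaceOU.StandingHypothesis A S Q y) :
    HalfSpaceOU.IsContractionSemigroup (HalfSpaceOU.P S Q y) ∧
    (∀ t : ℝ≥0, 0 < t →
      (∀ f ∈ HalfSpaceOU.Bb (HalfSpaceOU.closedHalf y),
        HalfSpaceOU.P S Q y t f ∈ HalfSpaceOU.UC0 y) ∧
      (∀ f ∈ HalfSpaceOU.Bb (HalfSpaceOU.openHalf y),
        HalfSpaceOU.POpen S Q y t f ∈ HalfSpaceOU.UC0 y)) ∧
    (∀ f ∈ HalfSpaceOU.C0 y, ∀ x : HalfSpaceOU.closedHalf y,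
      Continuous fun t : ℝ≥0 => HalfSpaceOU.P S Q y t f x) := by
  have : SecondCountableTopology H := UniformSpace.secondCountable_of_separable H
  refine ⟨hyp.isContractionSemigroup hy, fun t ht => ⟨fun f hf => hyp.P_mem_UC0 hy ht hf,
    fun f hf => ?_⟩, fun f hf x => ?_⟩
  · have h : HalfSpaceOU.POpen S Q y t f
        = HalfSpaceOU.P S Q y t (HalfSpaceOU.zeroExt y f) := by
      rw [HalfSpaceOU.POpen, HalfSpaceOU.extOpen_eq, HalfSpaceOU.P]
    rw [h]
    exact hyp.P_mem_UC0 hy ht (HalfSpaceOU.zeroExt_mem_Bb hf)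
  · obtain ⟨C, hC⟩ := hf.2.1
    exact hyp.continuous_ouT_time (HalfSpaceOU.continuous_extClosed hy hf)
      (HalfSpaceOU.abs_extClosed_le hC) x
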